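/- \textbf{Setting.} A setting $(N,M,\mathbf q)$ consists of a finite set $N$ of $n$ agents, a finite set $M$ of $m$ objects and capacities $q_j\in\mathbb N$, $j\in M$, with $n\le\sum_{j\in M} q_j$. A type $t$ is a strict total order on $M$ (identified with the set of utility functions $u:M\to\mathbb R$ such that $u(a)>u(b)$ if and only if $a$ is preferred to $b$ under $t$), and $T$ is the set of types. An allocation is a matrix $x\in[0,1]^{N\times M}$ with $\sum_j x_{i,j}=1$ for all $i$ and $\sum_i x_{i,j}\le q_j$ for all $j$. A mechanism $f$ maps each type profile $\mathbf t=(t_i,t_{-i})\in T^n$ to an allocation $f(\mathbf t)$, and $f_i(\mathbf t)$ is the row of agent $i$. For $\beta\in[0,1]$ the hybrid is $h_\beta(f,g)=(1-\beta)f+\beta g$; it is non-trivial if $\beta\in(0,1)$. \textbf{Incentives.} $f$ is strategyproof if $\langle u_i, f_i(t_i,t_{-i})-f_i(t_i',t_{-i})\rangle\ge 0$ for all $i$, all $(t_i,t_{-i})\in T^n$, all $t_i'\in T$ and all $u_i\in t_i$. It is $\mathrm{URBI}(r)$-partially strategyproof if this holds for all those $u_i\in t_i$ that satisfy $\mathrm{URBI}(r)$,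 i.e., $r\,(u(a)-\min u)\ge u(b)-\min u$ whenever $u(a)>u(b)$. Types are neighbors if they differ by a swap of two objects of adjacent ranks. $g$ is weakly invariant if, whenever an agent $i$ changes its report from $t_i$ to a neighbor $t_i'$ by swapping adjacent objects $a\succ b$, its probability of each object that it strictly prefers to $a$ is unchanged. $g$ is weakly less varying than $f$ if, for neighbors $t_i,t_i'$, $g_i(t_i,t_{-i})\ne g_i(t_i',t_{-i})$ implies $f_i(t_i,t_{-i})\neq f_i(t_i',t_{-i})$. The pair $(f,g)$ is hybrid-admissible if $f$ is strategyproof and $g$ is weakly invariant and weakly less varying than $f$. \textbf{Efficiency.} $x$ ordinally dominates $y$ at $\mathbf t$ if $\sum_{j\succ_i b}x_{i,j}\ge\sum_{j\succ_i b}y_{i,j}$ for all agents $i$ and all objects $b$, and strictly so if one of these inequalities is strict. $g$ (weakly) imperfectly ordinally dominates $f$ if $g(\mathbf t)$ ordinally dominates $f(\mathbf t)$ at every $\mathbf t$ at which one of the two allocations ordinally dominates the other; it strictly imperfectly ordinally dominates $f$ if in addition $g(\mathbf t)$ strictly ordinally dominates $f(\mathbf t)$ for some $\mathbf t$. \textbf{Mechanisms.}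 $\mathrm{RSD}$ (Random Serial Dictatorship) draws one of the $n!$ orderings of the agents uniformly at random and lets the agents pick, in this order, their most preferred object among those with remaining capacity. $\mathrm{PS}$ (Probabilistic Serial) lets all agents eat simultaneously, at unit speed from time $0$ to time $1$, from their most preferred object that is not yet exhausted, where $q_j$ units of object $j$ are available at time $0$; the probabilities are the shares eaten at time $1$. \textbf{Claim.} In every setting: (1) the pair $(\mathrm{RSD},\mathrm{PS})$ is hybrid-admissible; (2) for every $\beta\in(0,1]$, $h_\beta(\mathrm{RSD},\mathrm{PS})$ imperfectly ordinally dominates $\mathrm{RSD}$, and it does so strictly if $\mathrm{PS}(\mathbf t)$ strictly ordinally dominates $\mathrm{RSD}(\mathbf t)$ for some type profile $\mathbf t$ of the setting; (3) for every $r\in[0,1)$ there is $\beta\in(0,1)$ such that $h_\beta(\mathrm{RSD},\mathrm{PS})$ is $\mathrm{URBI}(r)$-partially strategyproof and imperfectly ordinally dominates $\mathrm{RSD}$. Moreover, (4) there is a setting in which $\mathrm{PS}$ strictly imperfectly ordinally dominates $\mathrm{RSD}$ and in which for every $r\in[0,1)$ there is $\beta\in(0,1)$ such that $h_\beta(\mathrm{RSD},\mathrm{PS})$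 is $\mathrm{URBI}(r)$-partially strategyproof and strictly imperfectly ordinally dominates $\mathrm{RSD}$. -/

import Mathlib

open scoped BigOperators

noncomputable section

/-- A setting: agents `N`, objects `M`, capacities `cap`, with supply at least demand. -/
structure Setting (N M : Type*) [Fintype N] [Fintype M] where
  cap : M → ℕ
  supply : Fintype.card N ≤ ∑ j, cap j

/-- A strict preference ordering of the finite set `M`, given by the rank of each object:
rank `0` is the first choice, and `a` is strictly preferred to `b` iff `t a < t b`. -/
abbrev Pref (M : Type*) [Fintype M] := M ≃ Fin (Fintype.card M)

/-- `a` is strictly preferred to `b` under `t`. -/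
def Pref.Prefers {M : Type*} [Fintype M] (t : Pref M) (a b : M) : Prop := t a < t b

/-- The utility `u` (without indifferences) belongs to the type `t`. -/
def Pref.Consistent {M : Type*} [Fintype M] (t : Pref M) (u : M → ℝ) : Prop :=
  ∀ a b, t.Prefers a b ↔ u b < u a

/-- `t'` arises from `t` by swapping the objects `a` and `b`, where `b` is ranked directly
below `a` under `t`. -/
def Pref.IsAdjacentSwap {M : Type*} [Fintype M] [DecidableEq M] (t t' : Pref M) (a b : M) : Prop :=
  (t b : ℕ) = (t a : ℕ) + 1 ∧ t' = (Equiv.swap a b).trans t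

/-- The neighborhood of `t`: all types that differ from `t` by one swap of adjacent objects. -/
def Pref.neighborhood {M : Type*} [Fintype M] [DecidableEq M] (t : Pref M) : Set (Pref M) :=
  {t' | ∃ a b, t.IsAdjacentSwap t' a b}

/-- A (probabilistic) allocation: agent `i` gets object `j` with probability `prob i j`. -/
@[ext]
structure Allocation {N M : Type*} [Fintype N] [Fintype M] (S : Setting N M) where
  prob : N → M → ℝ
  mem_Icc : ∀ i j, prob i j ∈ Set.Icc (0 : ℝ) 1
  fulfillment : ∀ i, ∑ j, prob i j = 1
  capacity : ∀ j, ∑ i, prob i j ≤ S.cap j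

/-- An (ordinal) mechanism maps profiles of preference orderings to allocations. -/
abbrev Mechanism {N M : Type*} [Fintype N] [Fintype M] (S : Setting N M) :=
  (N → Pref M) → Allocation S

section Properties

variable {N M : Type*} [Fintype N] [Fintype M] [DecidableEq N] [DecidableEq M] {S : Setting N M}

/-- Truthful reporting maximizes expected utility, for all consistent utilities. -/
def Mechanism.Strategyproof (f : Mechanism S) : Prop :=
  ∀ (i : N) (t : N → Pref M) (t' : Pref M) (u : M → ℝ), (t i).Consistent u →
    0 ≤ ∑ j, u j * ((f t).prob i j - (f (Function.update t i t')).prob i j)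

/-- Uniformly relatively bounded indifference with bound `r`; `⨅ c, u c` is the minimum of `u`. -/
def URBI (r : ℝ) (u : M → ℝ) : Prop :=
  ∀ a b, u b < u a → u b - (⨅ c, u c) ≤ r * (u a - ⨅ c, u c)

/-- `URBI(r)`-partial strategyproofness. -/
def Mechanism.PartiallyStrategyproof (r : ℝ) (f : Mechanism S) : Prop :=
  ∀ (i : N) (t : N → Pref M) (t' : Pref M) (u : M → ℝ), (t i).Consistent u → URBI r u →
    0 ≤ ∑ j, u j * ((f t).prob i j - (f (Function.update t i t')).prob i j)

/-- If an agent swaps the adjacent objects `a` and `b`, then its probabilities for the objects that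
it strictly prefers to `a` do not change. -/
def Mechanism.WeaklyInvariant (f : Mechanism S) : Prop :=
  ∀ (i : N) (t : N → Pref M) (t' : Pref M) (a b : M), (t i).IsAdjacentSwap t' a b →
    ∀ j, (t i).Prefers j a → (f t).prob i j = (f (Function.update t i t')).prob i j

/-- `g` is weakly less varying than `f`. -/
def Mechanism.WeaklyLessVarying (g f : Mechanism S) : Prop :=
  ∀ (i : N) (t : N → Pref M) (t' : Pref M), t' ∈ (t i).neighborhood →
    (g t).prob i ≠ (g (Function.update t i t')).prob i →
    (f t).prob i ≠ (f (Function.update t i t')).prob i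

/-- The pair `(f, g)` is hybrid-admissible. -/
structure HybridAdmissible (f g : Mechanism S) : Prop where
  strategyproof : f.Strategyproof
  weaklyInvariant : g.WeaklyInvariant
  weaklyLessVarying : g.WeaklyLessVarying f

end Properties

section Dominance

variable {N M : Type*} [Fintype N] [Fintype M] {S : Setting N M}

open Classical in
/-- The total weight under `v` of the objects that `t` strictly prefers to `b`. -/
def upperWeight (t : Pref M) (v : M → ℝ) (b : M) : ℝ :=
  ∑ j ∈ Finset.univ.filter (fun j => t.Prefers j b), v j

/-- The allocation vector `v` first order-stochastically dominates `w` for the type `t`. -/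
def FOSD (t : Pref M) (v w : M → ℝ) : Prop :=
  ∀ b, upperWeight t w b ≤ upperWeight t v b

/-- `x` (weakly) ordinally dominates `y` at the type profile `t`. -/
def OrdDominates (t : N → Pref M) (x y : Allocation S) : Prop :=
  ∀ i, FOSD (t i) (x.prob i) (y.prob i)

/-- `x` strictly ordinally dominates `y` at the type profile `t`. -/
def StrictOrdDominates (t : N → Pref M) (x y : Allocation S) : Prop :=
  OrdDominates t x y ∧
    ∃ i b, upperWeight (t i) (y.prob i) b < upperWeight (t i) (x.prob i) b

/-- `g` weakly imperfectly ordinally dominates `f`: it ordinally dominates `f` at every type profile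
where the two allocations are comparable by ordinal dominance. -/
def ImperfectOrdDominates (g f : Mechanism S) : Prop :=
  ∀ t, OrdDominates t (g t) (f t) ∨ OrdDominates t (f t) (g t) → OrdDominates t (g t) (f t)

/-- `g` strictly imperfectly ordinally dominates `f`. -/
def StrictImperfectOrdDominates (g f : Mechanism S) : Prop :=
  ImperfectOrdDominates g f ∧ ∃ t, StrictOrdDominates t (g t) (f t)

end Dominance

section Hybrid

variable {N M : Type*} [Fintype N] [Fintype M] {S : Setting N M}

/-- The convex combination `(1 - β) x + β y` of two allocations. -/
def Allocation.mix (β : ℝ) (hβ : β ∈ Set.Icc (0 : ℝ) 1) (x y : Allocation S) : Allocation S where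
  prob i j := (1 - β) * x.prob i j + β * y.prob i j
  mem_Icc i j := by
    have h := convex_Icc (0 : ℝ) 1 (x.mem_Icc i j) (y.mem_Icc i j)
      (sub_nonneg.2 hβ.2) hβ.1 (by ring)
    simpa [smul_eq_mul] using h
  fulfillment i := by
    rw [Finset.sum_add_distrib, ← Finset.mul_sum, ← Finset.mul_sum, x.fulfillment, y.fulfillment]
    ring
  capacity j := by
    rw [Finset.sum_add_distrib, ← Finset.mul_sum, ← Finset.mul_sum]
    have h1 := mul_le_mul_of_nonneg_left (x.capacity j) (sub_nonneg.2 hβ.2)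
    have h2 := mul_le_mul_of_nonneg_left (y.capacity j) hβ.1
    linarith

/-- The `β`-hybrid of the mechanisms `f` and `g`. -/
def hybrid (β : ℝ) (hβ : β ∈ Set.Icc (0 : ℝ) 1) (f g : Mechanism S) : Mechanism S :=
  fun t => Allocation.mix β hβ (f t) (g t)

end Hybrid

section Favorite

variable {M : Type*} [Fintype M]

/-- `j` is the most preferred object in the set `A` under `t`. -/
def IsFavorite (t : Pref M) (A : Set M) (j : M) : Prop :=
  j ∈ A ∧ ∀ k ∈ A, t j ≤ t k

theorem IsFavorite.eq {t : Pref M} {A : Set M} {j k : M}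
    (hj : IsFavorite t A j) (hk : IsFavorite t A k) : j = k :=
  t.injective (le_antisymm (hj.2 k hk.1) (hk.2 j hj.1))

theorem IsFavorite.exists (t : Pref M) {A : Set M} (hA : A.Nonempty) : ∃ j, IsFavorite t A j := by
  classical
  obtain ⟨j, hj, hmin⟩ := Set.exists_min_image A t (Set.toFinite A) hA
  exact ⟨j, hj, hmin⟩

open Classical in
theorem IsFavorite.sum_ite (t : Pref M) {A : Set M} (hA : A.Nonempty) (c : ℝ) :
    ∑ j, (if IsFavorite t A j then c else 0) = c := by
  obtain ⟨j, hj⟩ := IsFavorite.exists t hA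
  rw [Finset.sum_eq_single j]
  · simp [hj]
  · intro k _ hk
    exact if_neg fun h => hk (h.eq hj)
  · simp

end Favorite

section RSD

variable {N M : Type*} [Fintype N] [Fintype M]

open Classical in
/-- The capacities that remain after the first `k` agents in the ordering `π` have picked, one after
the other, their most preferred object among those with remaining capacity. -/
def remainingCap (S : Setting N M) (t : N → Pref M) (π : Fin (Fintype.card N) ≃ N) : ℕ → M → ℕ
  | 0 => S.cap
  | k + 1 => fun j =>
      if ∃ h : k < Fintype.card N,
          IsFavorite (t (π ⟨k, h⟩)) {a | 0 < remainingCap S t π k a} j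
      then remainingCap S t π k j - 1 else remainingCap S t π k j

open Classical in
/-- The deterministic assignment of the serial dictatorship with ordering `π`, as a 0/1-matrix:
agent `i` gets its most preferred object among those that remain when it is its turn. -/
def serialDictatorship (S : Setting N M) (t : N → Pref M) (π : Fin (Fintype.card N) ≃ N)
    (i : N) (j : M) : ℝ :=
  if IsFavorite (t i) {a | 0 < remainingCap S t π (π.symm i) a} j then 1 else 0

theorem remainingCap_sum (S : Setting N M) (t : N → Pref M) (π : Fin (Fintype.card N) ≃ N)
    (k : ℕ) (hk : k ≤ Fintype.card N) :
    (∑ j, (remainingCap S t π k j : ℝ)) = ∑ j, (S.cap j : ℝ) - k ∧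
    ∀ j, (remainingCap S t π k j : ℝ) + ∑ i, (if ((π.symm i : Fin _) : ℕ) < k then
      serialDictatorship S t π i j else 0) = S.cap j := by
  classical
  induction k with
  | zero => simp [remainingCap]
  | succ k ih =>
    obtain ⟨ih1, ih2⟩ := ih (by omega)
    have hk' : k < Fintype.card N := by omega
    have hne : ({a | 0 < remainingCap S t π k a} : Set M).Nonempty := by
      by_contra h
      rw [Set.not_nonempty_iff_eq_empty] at h
      have h0 : ∀ a, remainingCap S t π k a = 0 := by
        intro a
        by_contra ha
        have : a ∈ ({a | 0 < remainingCap S t π k a} : Set M) := Nat.pos_of_ne_zero ha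
        rw [h] at this
        exact this
      have hs : (Fintype.card N : ℝ) ≤ ∑ j, (S.cap j : ℝ) := by exact_mod_cast S.supply
      have hkr : (k : ℝ) < Fintype.card N := by exact_mod_cast hk'
      simp only [h0, Nat.cast_zero, Finset.sum_const_zero] at ih1
      linarith
    have hstep : ∀ j, (remainingCap S t π (k + 1) j : ℝ) = remainingCap S t π k j -
        (if IsFavorite (t (π ⟨k, hk'⟩)) {a | 0 < remainingCap S t π k a} j then 1 else 0) := by
      intro j
      by_cases hf : IsFavorite (t (π ⟨k, hk'⟩)) {a | 0 < remainingCap S t π k a} j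
      · have hpos : 1 ≤ remainingCap S t π k j := hf.1
        have hex : ∃ h : k < Fintype.card N,
          IsFavorite (t (π ⟨k, h⟩)) {a | 0 < remainingCap S t π k a} j := ⟨hk', hf⟩
        simp only [remainingCap]
        rw [if_pos hex, if_pos hf, Nat.cast_sub hpos, Nat.cast_one]
      · have hex : ¬ ∃ h : k < Fintype.card N,
          IsFavorite (t (π ⟨k, h⟩)) {a | 0 < remainingCap S t π k a} j := fun ⟨_, h⟩ => hf h
        simp only [remainingCap]
        rw [if_neg hex, if_neg hf, sub_zero]
    refine ⟨?_, fun j => ?_⟩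
    · rw [Finset.sum_congr rfl fun j _ => hstep j, Finset.sum_sub_distrib, ih1,
        IsFavorite.sum_ite _ hne]
      push_cast
      ring
    · have hsplit : ∀ i, (if ((π.symm i : Fin _) : ℕ) < k + 1 then
            serialDictatorship S t π i j else 0) =
          (if ((π.symm i : Fin _) : ℕ) < k then serialDictatorship S t π i j else 0) +
          (if i = π ⟨k, hk'⟩ then
            (if IsFavorite (t (π ⟨k, hk'⟩)) {a | 0 < remainingCap S t π k a} j then 1 else 0)
            else 0) := by
        intro i
        by_cases hi : i = π ⟨k, hk'⟩
        · subst hi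
          simp [serialDictatorship]
        · have : ((π.symm i : Fin _) : ℕ) ≠ k := by
            intro h
            apply hi
            rw [← Equiv.symm_apply_eq]
            exact Fin.ext h
          have h2 : ((π.symm i : Fin _) : ℕ) < k + 1 ↔ ((π.symm i : Fin _) : ℕ) < k := by omega
          simp [hi, h2]
      rw [Finset.sum_congr rfl fun i _ => hsplit i, Finset.sum_add_distrib, hstep,
        Finset.sum_ite_eq' Finset.univ, if_pos (Finset.mem_univ _), ← ih2 j]
      ring

theorem serialDictatorship_nonneg (S : Setting N M) (t : N → Pref M)
    (π : Fin (Fintype.card N) ≃ N) (i : N) (j : M) : 0 ≤ serialDictatorship S t π i j := by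
  unfold serialDictatorship
  split_ifs <;> norm_num

theorem serialDictatorship_sum (S : Setting N M) (t : N → Pref M)
    (π : Fin (Fintype.card N) ≃ N) (i : N) : ∑ j, serialDictatorship S t π i j = 1 := by
  classical
  have hk := (π.symm i).isLt
  obtain ⟨h1, -⟩ := remainingCap_sum S t π (π.symm i) hk.le
  apply IsFavorite.sum_ite
  by_contra h
  rw [Set.not_nonempty_iff_eq_empty] at h
  have h0 : ∀ a, remainingCap S t π (π.symm i) a = 0 := by
    intro a
    by_contra ha
    have : a ∈ ({a | 0 < remainingCap S t π (π.symm i) a} : Set M) := Nat.pos_of_ne_zero ha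
    rw [h] at this
    exact this
  have hs : (Fintype.card N : ℝ) ≤ ∑ j, (S.cap j : ℝ) := by exact_mod_cast S.supply
  have hkr : (((π.symm i : Fin _) : ℕ) : ℝ) < Fintype.card N := by exact_mod_cast hk
  simp only [h0, Nat.cast_zero, Finset.sum_const_zero] at h1
  linarith

theorem serialDictatorship_cap (S : Setting N M) (t : N → Pref M)
    (π : Fin (Fintype.card N) ≃ N) (j : M) : ∑ i, serialDictatorship S t π i j ≤ S.cap j := by
  have h := (remainingCap_sum S t π _ le_rfl).2 j
  simp only [Fin.is_lt, if_true] at h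
  have : (0 : ℝ) ≤ remainingCap S t π (Fintype.card N) j := Nat.cast_nonneg _
  linarith

/-- Random Serial Dictatorship: the serial dictatorship with an ordering of the agents that is drawn
uniformly at random from all `n!` orderings. -/
def RSD [DecidableEq N] (S : Setting N M) : Mechanism S := fun t =>
  have hc : ((Fintype.card (Fin (Fintype.card N) ≃ N) : ℕ) : ℝ) = (Fintype.card N).factorial := by
    rw [Fintype.card_equiv (Fintype.equivFin N).symm, Fintype.card_fin]
  have hpos : (0 : ℝ) < (Fintype.card N).factorial := by exact_mod_cast Nat.factorial_pos _
  have hnn : ∀ i j, 0 ≤ (∑ π : Fin (Fintype.card N) ≃ N, serialDictatorship S t π i j) /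
      (Fintype.card N).factorial := fun i j =>
    div_nonneg (Finset.sum_nonneg fun π _ => serialDictatorship_nonneg S t π i j) hpos.le
  have hsum : ∀ i, ∑ j, (∑ π : Fin (Fintype.card N) ≃ N, serialDictatorship S t π i j) /
      (Fintype.card N).factorial = 1 := fun i => by
    rw [← Finset.sum_div, Finset.sum_comm]
    simp only [serialDictatorship_sum, Finset.sum_const, Finset.card_univ, nsmul_eq_mul, mul_one]
    rw [hc, div_self hpos.ne']
  { prob := fun i j => (∑ π : Fin (Fintype.card N) ≃ N, serialDictatorship S t π i j) /
      (Fintype.card N).factorial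
    mem_Icc := fun i j => ⟨hnn i j, by
      rw [← hsum i]
      exact Finset.single_le_sum (f := fun j => (∑ π : Fin (Fintype.card N) ≃ N,
        serialDictatorship S t π i j) / ((Fintype.card N).factorial : ℝ))
        (fun j _ => hnn i j) (Finset.mem_univ j)⟩
    fulfillment := hsum
    capacity := fun j => by
      rw [← Finset.sum_div, Finset.sum_comm, div_le_iff₀ hpos, ← hc]
      calc _ ≤ ∑ _π : Fin (Fintype.card N) ≃ N, (S.cap j : ℝ) :=
            Finset.sum_le_sum fun π _ => serialDictatorship_cap S t π j
        _ = _ := by simp [mul_comm] }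

end RSD

section PS

variable {N M : Type*} [Fintype N] [Fintype M]

/-- A state of the simultaneous eating algorithm: the current time, the amount that is left of each
object, and the share of each object that each agent has eaten so far. -/
structure EatingState (N M : Type*) where
  time : ℝ
  rem : M → ℝ
  share : N → M → ℝ

/-- The objects that are not yet exhausted. -/
def EatingState.available (s : EatingState N M) : Set M := {j | 0 < s.rem j}

open Classical in
/-- The agents that eat from `j`: those whose most preferred available object is `j`. -/
def EatingState.eaters (t : N → Pref M) (s : EatingState N M) (j : M) : Finset N :=
  Finset.univ.filter fun i => IsFavorite (t i) s.available j

open Classical in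
/-- The time until either some object that is being eaten is exhausted, where each agent eats at
unit speed, or the time `1` is reached, whichever happens first. -/
def EatingState.stepLength (t : N → Pref M) (s : EatingState N M) : ℝ :=
  (insert (1 - s.time)
    ((Finset.univ.filter fun j => (s.eaters t j).Nonempty).image
      fun j => s.rem j / (s.eaters t j).card)).min' (Finset.insert_nonempty _ _)

open Classical in
/-- During one step, each agent eats at unit speed from its most preferred available object. -/
def EatingState.step (t : N → Pref M) (s : EatingState N M) : EatingState N M where
  time := s.time + s.stepLength t
  rem j := s.rem j - (s.eaters t j).card * s.stepLength t
  share i j := s.share i j + if IsFavorite (t i) s.available j then s.stepLength t else 0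

/-- At time `0` all objects are completely available. -/
def EatingState.init (S : Setting N M) : EatingState N M where
  time := 0
  rem j := S.cap j
  share _ _ := 0

/-- The state after `k` steps. -/
def eatingState (S : Setting N M) (t : N → Pref M) (k : ℕ) : EatingState N M :=
  (EatingState.step t)^[k] (EatingState.init S)

theorem eatingState_succ (S : Setting N M) (t : N → Pref M) (k : ℕ) :
    eatingState S t (k + 1) = (eatingState S t k).step t :=
  Function.iterate_succ_apply' _ _ _

/-- Bookkeeping facts that hold in every state of the algorithm. -/
structure EatingState.Valid (S : Setting N M) (s : EatingState N M) : Prop where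
  time_le : s.time ≤ 1
  rem_nonneg : ∀ j, 0 ≤ s.rem j
  share_nonneg : ∀ i j, 0 ≤ s.share i j
  rem_add : ∀ j, s.rem j + ∑ i, s.share i j = S.cap j
  sum_share : ∀ i, ∑ j, s.share i j = s.time

theorem EatingState.Valid.time_eq {S : Setting N M} {s : EatingState N M} (hs : s.Valid S) (_ : N)
    (h : ¬ s.available.Nonempty) : s.time = 1 := by
  rw [Set.not_nonempty_iff_eq_empty] at h
  have h0 : ∀ j, s.rem j = 0 := fun j => by
    refine le_antisymm (not_lt.1 fun hj => ?_) (hs.rem_nonneg j)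
    have : j ∈ s.available := hj
    rw [h] at this
    exact this
  have h1 : ∑ j, (S.cap j : ℝ) = Fintype.card N * s.time := by
    simp only [← hs.rem_add, h0, zero_add]
    rw [Finset.sum_comm]
    simp [hs.sum_share]
  have h2 : (Fintype.card N : ℝ) ≤ ∑ j, (S.cap j : ℝ) := by exact_mod_cast S.supply
  have h3 : (0 : ℝ) < Fintype.card N := by
    exact_mod_cast Fintype.card_pos_iff.2 ⟨‹N›⟩
  refine le_antisymm hs.time_le ?_
  rw [h1] at h2
  by_contra h4
  have := mul_lt_mul_of_pos_left (not_le.1 h4) h3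
  linarith

theorem EatingState.stepLength_le (t : N → Pref M) (s : EatingState N M) :
    s.stepLength t ≤ 1 - s.time :=
  Finset.min'_le _ _ (Finset.mem_insert_self _ _)

theorem EatingState.stepLength_mul_le (t : N → Pref M) {S : Setting N M} {s : EatingState N M}
    (hs : s.Valid S) (j : M) : (s.eaters t j).card * s.stepLength t ≤ s.rem j := by
  classical
  by_cases h : (s.eaters t j).Nonempty
  · have hc : (0 : ℝ) < (s.eaters t j).card := by exact_mod_cast h.card_pos
    have h1 : s.stepLength t ≤ s.rem j / (s.eaters t j).card :=
      Finset.min'_le _ _ (Finset.mem_insert_of_mem (Finset.mem_image_of_mem _ (by simpa using h)))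
    rw [le_div_iff₀ hc] at h1
    linarith
  · rw [Finset.not_nonempty_iff_eq_empty] at h
    simpa [h] using hs.rem_nonneg j

theorem EatingState.stepLength_cases (t : N → Pref M) (s : EatingState N M) :
    s.stepLength t = 1 - s.time ∨
      ∃ j, (s.eaters t j).Nonempty ∧ s.stepLength t = s.rem j / (s.eaters t j).card := by
  classical
  have h := Finset.min'_mem _ (Finset.insert_nonempty (1 - s.time)
    ((Finset.univ.filter fun j => (s.eaters t j).Nonempty).image
      fun j => s.rem j / ((s.eaters t j).card : ℝ)))
  rw [Finset.mem_insert, Finset.mem_image] at h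
  rcases h with h | ⟨j, hj, h⟩
  · exact Or.inl h
  · exact Or.inr ⟨j, by simpa using hj, h.symm⟩

theorem EatingState.stepLength_nonneg (t : N → Pref M) {S : Setting N M} {s : EatingState N M}
    (hs : s.Valid S) : 0 ≤ s.stepLength t := by
  rcases s.stepLength_cases t with h | ⟨j, -, h⟩ <;> rw [h]
  · linarith [hs.time_le]
  · exact div_nonneg (hs.rem_nonneg j) (Nat.cast_nonneg _)

theorem EatingState.Valid.step {S : Setting N M} {s : EatingState N M} (hs : s.Valid S)
    (t : N → Pref M) : (s.step t).Valid S where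
  time_le := by
    have := s.stepLength_le t
    simp only [EatingState.step]
    linarith
  rem_nonneg j := sub_nonneg.2 (EatingState.stepLength_mul_le t hs j)
  share_nonneg i j := by
    have := EatingState.stepLength_nonneg t hs
    simp only [EatingState.step]
    have h := hs.share_nonneg i j
    split_ifs <;> linarith
  rem_add j := by
    classical
    simp only [EatingState.step, Finset.sum_add_distrib, ← hs.rem_add j]
    rw [← Finset.sum_filter, Finset.sum_const, nsmul_eq_mul]
    simp only [EatingState.eaters]
    ring
  sum_share i := by
    classical
    simp only [EatingState.step, Finset.sum_add_distrib, hs.sum_share]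
    by_cases h : s.available.Nonempty
    · rw [IsFavorite.sum_ite _ h]
    · have h1 := hs.time_eq i h
      have h2 := EatingState.stepLength_nonneg t hs
      have h3 := s.stepLength_le t
      have h4 : s.stepLength t = 0 := by linarith
      simp [h4]

theorem eatingState_valid (S : Setting N M) (t : N → Pref M) (k : ℕ) :
    (eatingState S t k).Valid S := by
  induction k with
  | zero =>
    exact ⟨zero_le_one, fun j => Nat.cast_nonneg _, fun _ _ => le_rfl,
      fun j => by simp [eatingState, EatingState.init],
      fun i => by simp [eatingState, EatingState.init]⟩
  | succ k ih =>
    rw [eatingState_succ]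
    exact ih.step t

open Classical in
theorem eatingState_progress (S : Setting N M) (t : N → Pref M) (k : ℕ) :
    (eatingState S t k).time = 1 ∨
      k ≤ (Finset.univ.filter fun j => (eatingState S t k).rem j = 0).card := by
  induction k with
  | zero => exact Or.inr (Nat.zero_le _)
  | succ k ih =>
    rw [eatingState_succ]
    have hs := eatingState_valid S t k
    generalize eatingState S t k = s at *
    have h0 := EatingState.stepLength_nonneg t hs
    rcases ih with h | h
    · left
      exact le_antisymm (hs.step t).time_le (by simp only [EatingState.step]; linarith)
    · rcases s.stepLength_cases t with h1 | ⟨j, hj, h1⟩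
      · left
        simp only [EatingState.step]
        linarith
      · right
        refine Nat.succ_le_of_lt (lt_of_le_of_lt h (Finset.card_lt_card ?_))
        obtain ⟨i, hi⟩ := hj
        have hpos : 0 < s.rem j := by
          have := (Finset.mem_filter.1 hi).2.1
          exact this
        have hc : ((s.eaters t j).card : ℝ) ≠ 0 := by
          exact_mod_cast (Finset.card_pos.2 ⟨i, hi⟩).ne'
        rw [Finset.ssubset_iff_of_subset]
        · refine ⟨j, ?_, by simp [hpos.ne']⟩
          rw [Finset.mem_filter]
          refine ⟨Finset.mem_univ j, ?_⟩
          simp only [EatingState.step]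
          rw [h1, mul_div_cancel₀ _ hc, sub_self]
        · intro a ha
          simp only [Finset.mem_filter, Finset.mem_univ, true_and] at ha ⊢
          refine le_antisymm ?_ ((hs.step t).rem_nonneg a)
          have : (0 : ℝ) ≤ (s.eaters t a).card * s.stepLength t :=
            mul_nonneg (Nat.cast_nonneg _) h0
          simp only [EatingState.step]
          linarith

theorem eatingState_time (S : Setting N M) (t : N → Pref M) (i : N) :
    (eatingState S t (Fintype.card M)).time = 1 := by
  classical
  rcases eatingState_progress S t (Fintype.card M) with h | h
  · exact h
  · apply (eatingState_valid S t _).time_eq i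
    rintro ⟨j, hj⟩
    have h1 := Finset.eq_univ_of_card _ (le_antisymm (Finset.card_le_univ _) h)
    have h2 := Finset.mem_univ j
    rw [← h1, Finset.mem_filter] at h2
    exact absurd h2.2 (ne_of_gt hj)

/-- Probabilistic Serial: the shares eaten at time `1` by the simultaneous eating algorithm, in which
all agents eat at unit speed. Every step exhausts an object or reaches time `1`, so that `m` steps,
where `m` is the number of objects, suffice to reach time `1`. -/
def PS (S : Setting N M) : Mechanism S := fun t =>
  have hv := eatingState_valid S t (Fintype.card M)
  have hsum : ∀ i, ∑ j, (eatingState S t (Fintype.card M)).share i j = 1 := fun i => by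
    rw [hv.sum_share, eatingState_time S t i]
  { prob := (eatingState S t (Fintype.card M)).share
    mem_Icc := fun i j => ⟨hv.share_nonneg i j, by
      rw [← hsum i]
      exact Finset.single_le_sum (fun j _ => hv.share_nonneg i j) (Finset.mem_univ j)⟩
    fulfillment := hsum
    capacity := fun j => by
      have h1 := hv.rem_add j
      have h2 := hv.rem_nonneg j
      linarith }

end PS

end

/-! Everything is reduced to swaps of adjacent objects `a ≻ b`. In a serial dictatorship such a swap
matters to the agent only if `a` is its best remaining object and `b` remains too; then it gets `b`
instead of `a`. Averaging over orderings, the swap under RSD moves a mass `d` from `a` to `b`, where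
`d` is a multiple of `1/n!` (`RSD_swapsBy`). Any misreport can be led back to the truth by swaps
that each restore a true comparison (`Pref.exists_adjacentSwap_toward`), so RSD is strategyproof.

For the hybrid, such a path is chosen that objects reported below `a` are also truly worse than `a`.
If a swap changes the PS row, RSD changes by at least `1/n!`, which under URBI(r) is worth at least
`(1 - r)/n!` times the utility of `a` above the minimum. PS loses at most `m` times that utility,
because objects above `a` are unaffected. A small weight on PS is therefore harmless
(`Mechanism.SwapsBy.exists_hybrid`).

That RSD changes whenever PS does rests on Hall's theorem. Before time 1 the copies of the exhausted
objects can be assigned to distinct agents other than `i` who ate from them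
(`EatingState.Valid.exists_assignment`). Ordering these agents by exhaustion time and placing `i`
next gives a serial dictatorship in which `i` faces exactly the objects still available in the
eating algorithm (`exists_ordering_of_eatingState`).

For efficiency, an allocation dominating PS agrees with it on exhausted objects, by induction along
the eating process; hence PS dominates it back (`OrdDominates.PS_dominates`). A hybrid with positive
weight compares with RSD in the same direction as PS does. Strictness is witnessed by an instance
with four agents. -/

noncomputable section

/-! ### Adjacent swaps and paths of swaps to the truth -/

section Swap

variable {M : Type*} [Fintype M] [DecidableEq M] {t t' : Pref M} {a b : M}

theorem Pref.IsAdjacentSwap.ne (h : t.IsAdjacentSwap t' a b) : a ≠ b := by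
  rintro rfl
  have := h.1
  omega

theorem Pref.IsAdjacentSwap.apply_left (h : t.IsAdjacentSwap t' a b) : t' a = t b := by
  simp [h.2]

theorem Pref.IsAdjacentSwap.apply_right (h : t.IsAdjacentSwap t' a b) : t' b = t a := by
  simp [h.2]

theorem Pref.IsAdjacentSwap.apply_of_ne (h : t.IsAdjacentSwap t' a b) {c : M} (ha : c ≠ a)
    (hb : c ≠ b) : t' c = t c := by
  simp [h.2, Equiv.swap_apply_of_ne_of_ne ha hb]

/-- An adjacent swap reverses only the comparison of the two swapped objects. -/
theorem Pref.IsAdjacentSwap.lt_iff (h : t.IsAdjacentSwap t' a b) {c d : M}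
    (h1 : ¬ (c = a ∧ d = b)) (h2 : ¬ (c = b ∧ d = a)) : t' c < t' d ↔ t c < t d := by
  have hab := h.1
  have inj : ∀ {x y : M}, x ≠ y → (t x : ℕ) ≠ t y := fun hxy he => hxy (t.injective (Fin.ext he))
  simp only [Fin.lt_def]
  by_cases hca : c = a
  · subst hca
    by_cases hdb : d = b
    · exact absurd ⟨rfl, hdb⟩ h1
    · by_cases hdc : d = c
      · subst hdc
        simp
      · rw [h.apply_left, h.apply_of_ne hdc hdb]
        have := inj hdc
        have := inj hdb
        omega
  · by_cases hcb : c = b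
    · subst hcb
      by_cases hda : d = a
      · exact absurd ⟨rfl, hda⟩ h2
      · by_cases hdc : d = c
        · subst hdc
          simp
        · rw [h.apply_right, h.apply_of_ne hda hdc]
          have := inj hdc
          have := inj hda
          omega
    · rw [h.apply_of_ne hca hcb]
      have := inj hca
      have := inj hcb
      by_cases hda : d = a
      · subst hda
        rw [h.apply_left]
        omega
      · by_cases hdb : d = b
        · subst hdb
          rw [h.apply_right]
          omega
        · rw [h.apply_of_ne hda hdb]

theorem Pref.IsAdjacentSwap.isFavorite_right (h : t.IsAdjacentSwap t' a b) {A : Set M}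
    (ha : IsFavorite t A a) (hb : b ∈ A) : IsFavorite t' A b := by
  refine ⟨hb, fun k hk => ?_⟩
  rw [h.apply_right]
  by_cases hka : k = a
  · subst hka
    rw [h.apply_left]
    exact ha.2 b hb
  · by_cases hkb : k = b
    · subst hkb
      rw [h.apply_right]
    · rw [h.apply_of_ne hka hkb]
      exact ha.2 k hk

/-- The favorite object changes under an adjacent swap only if the first of the swapped objects is
the favorite and the second one is in the set. -/
theorem Pref.IsAdjacentSwap.isFavorite_iff (h : t.IsAdjacentSwap t' a b) {A : Set M}
    (hA : ¬ (IsFavorite t A a ∧ b ∈ A)) (j : M) : IsFavorite t' A j ↔ IsFavorite t A j := by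
  have hab : t a < t b := by
    rw [Fin.lt_def, h.1]
    exact Nat.lt_succ_self _
  constructor
  · rintro ⟨hj, hmin⟩
    refine ⟨hj, fun k hk => ?_⟩
    by_contra hlt
    rw [not_le] at hlt
    by_cases h1 : k = a ∧ j = b
    · obtain ⟨rfl, rfl⟩ := h1
      refine hA ⟨⟨hk, fun l hl => ?_⟩, hj⟩
      have h3 := hmin l hl
      rw [h.apply_right] at h3
      by_cases hlk : l = k
      · rw [hlk]
      · by_cases hlj : l = j
        · rw [hlj]
          exact hlt.le
        · rwa [h.apply_of_ne hlk hlj] at h3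
    · by_cases h2 : k = b ∧ j = a
      · obtain ⟨rfl, rfl⟩ := h2
        exact absurd hlt (not_lt.2 hab.le)
      · exact absurd ((h.lt_iff h1 h2).2 hlt) (not_lt.2 (hmin k hk))
  · rintro ⟨hj, hmin⟩
    refine ⟨hj, fun k hk => ?_⟩
    by_contra hlt
    rw [not_le] at hlt
    by_cases h1 : k = a ∧ j = b
    · obtain ⟨rfl, rfl⟩ := h1
      exact absurd hab (not_lt.2 (hmin k hk))
    · by_cases h2 : k = b ∧ j = a
      · obtain ⟨rfl, rfl⟩ := h2
        exact hA ⟨⟨hj, hmin⟩, hk⟩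
      · exact absurd ((h.lt_iff h1 h2).1 hlt) (not_lt.2 (hmin k hk))

/-- Every report `s ≠ t` arises by an adjacent swap from a report `s'` that is closer to `t`, such
that `s'` ranks below the first swapped object only objects that are also below it under `t`. -/
theorem Pref.exists_adjacentSwap_toward {s t : Pref M} (hst : s ≠ t) :
    ∃ (s' : Pref M) (a b : M), s'.IsAdjacentSwap s a b ∧ t a < t b ∧ (∀ j, s' a < s' j → t a < t j) ∧
      ∑ j, (s j : ℕ) * (t j : ℕ) < ∑ j, (s' j : ℕ) * (t j : ℕ) := by
  set m := Fintype.card M with hm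
  -- `g` lists the true ranks of the objects in reported order. The default `q` past the end makes
  -- `g` increasing there, so descents occur only between genuine positions.
  set g : ℕ → ℕ := fun q => if h : q < m then (t (s.symm ⟨q, h⟩) : ℕ) else q with hg
  have glt : ∀ q (h : q < m), g q = (t (s.symm ⟨q, h⟩) : ℕ) := fun q h => dif_pos h
  have gge : ∀ q, ¬ q < m → g q = q := fun q h => dif_neg h
  have gs : ∀ j, g (s j) = t j := fun j => by rw [glt _ (s j).isLt]; simp
  have gltm : ∀ q, q < m → g q < m := fun q h => by rw [glt q h]; exact Fin.isLt _
  have ginj : ∀ q, g q ≠ g (q + 1) := by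
    intro q he
    by_cases h1 : q + 1 < m
    · have h0 : q < m := by omega
      rw [glt q h0, glt _ h1] at he
      have := s.symm.injective (t.injective (Fin.ext he))
      simp at this
    · rw [gge _ h1] at he
      by_cases h0 : q < m
      · have := gltm q h0
        omega
      · rw [gge _ h0] at he
        omega
  have hex : ∃ q, q < m ∧ g (q + 1) < g q := by
    by_contra hno
    push Not at hno
    -- Without a descent, `t ∘ s⁻¹` is a strictly increasing bijection of `Fin m`, hence the
    -- identity, contradicting `s ≠ t`.
    have hmono : StrictMono g := by
      refine strictMono_nat_of_lt_succ fun q => ?_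
      by_cases h0 : q < m
      · exact lt_of_le_of_ne (hno q h0) (ginj q)
      · rw [gge _ h0, gge _ (by omega)]
        omega
    have hsm : StrictMono (fun p : Fin m => t (s.symm p)) := by
      intro p q hpq
      have := hmono (show (p : ℕ) < q from hpq)
      rw [glt _ p.isLt, glt _ q.isLt] at this
      exact this
    have hid : (fun p : Fin m => t (s.symm p)) = id := by
      refine hsm.range_inj strictMono_id |>.1 ?_
      have : Function.Surjective (fun p : Fin m => t (s.symm p)) :=
        t.surjective.comp s.symm.surjective
      rw [this.range_eq, Set.range_id]
    apply hst
    ext j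
    have := congrFun hid (s j)
    simp at this
    rw [this]
  classical
  -- Taking the last descent makes `g` increasing from `p + 1` on, so every object reported after
  -- `a` is also truly worse than `a`.
  set p := Nat.findGreatest (fun q => g (q + 1) < g q) m with hp
  obtain ⟨q0, hq0, hd0⟩ := hex
  have hdp : g (p + 1) < g p := Nat.findGreatest_spec (P := fun q => g (q + 1) < g q) hq0.le hd0
  have hafter : ∀ q, p < q → g q < g (q + 1) := by
    intro q hq
    by_cases hqm : q ≤ m
    · exact lt_of_le_of_ne (not_lt.1 (Nat.findGreatest_is_greatest (P := fun q => g (q + 1) < g q) hq hqm)) (ginj q)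
    · rw [gge _ (by omega), gge _ (by omega)]
      omega
  have hp1 : p + 1 < m := by
    by_contra hc
    rw [gge _ hc] at hdp
    by_cases h0 : p < m
    · have := gltm p h0
      omega
    · rw [gge _ h0] at hdp
      omega
  have hgt : ∀ q, p + 1 < q → g (p + 1) < g q := by
    intro q hq
    induction q, hq using Nat.le_induction with
    | base => exact hafter _ (by omega)
    | succ q hq ih => exact ih.trans (hafter q (by omega))
  have hp0 : p < m := by omega
  set b := s.symm ⟨p, hp0⟩ with hb
  set a := s.symm ⟨p + 1, hp1⟩ with ha
  have sb : (s b : ℕ) = p := by simp [hb]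
  have sa : (s a : ℕ) = p + 1 := by simp [ha]
  have hne : a ≠ b := fun h => by rw [h] at sa; omega
  have htab : t a < t b := by
    rw [Fin.lt_def, ← gs, ← gs, sa, sb]
    exact hdp
  set s' : Pref M := (Equiv.swap a b).trans s with hs'
  have hswap : s'.IsAdjacentSwap s a b := by
    constructor
    · simp [hs', sa, sb]
    · ext j
      simp [hs']
  have sa' : (s' a : ℕ) = p := by simp [hs', sb]
  have sb' : (s' b : ℕ) = p + 1 := by simp [hs', sa]
  refine ⟨s', a, b, hswap, htab, fun j hj => ?_, ?_⟩
  · rw [Fin.lt_def, sa'] at hj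
    by_cases hjb : j = b
    · rw [hjb]
      exact htab
    · have hja : j ≠ a := by
        rintro rfl
        omega
      rw [← hswap.apply_of_ne hja hjb] at hj
      have hjp : (s j : ℕ) ≠ p + 1 := fun he => hja (s.injective (Fin.ext (he.trans sa.symm)))
      rw [Fin.lt_def, ← gs, ← gs, sa]
      exact hgt _ (by omega)
  · have split : ∀ w : M → ℕ, ∑ j, w j = w a + w b + ∑ j ∈ (Finset.univ.erase a).erase b, w j := by
      intro w
      rw [← Finset.add_sum_erase Finset.univ w (Finset.mem_univ a),
        ← Finset.add_sum_erase (Finset.univ.erase a) w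
          (Finset.mem_erase.2 ⟨hne.symm, Finset.mem_univ b⟩), add_assoc]
    rw [split, split, sa, sb, sa', sb']
    have : ∑ j ∈ (Finset.univ.erase a).erase b, (s j : ℕ) * (t j : ℕ) =
        ∑ j ∈ (Finset.univ.erase a).erase b, (s' j : ℕ) * (t j : ℕ) := by
      refine Finset.sum_congr rfl fun j hj => ?_
      simp only [Finset.mem_erase] at hj
      rw [hswap.apply_of_ne hj.2.1 hj.1]
    -- Undoing the inversion raises the sum of products of ranks by exactly `t b - t a`.
    rw [this]
    rw [Fin.lt_def] at htab
    nlinarith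

end Swap

/-! ### Incentives from adjacent swaps -/

section HybridIncentives

variable {N M : Type*} [Fintype N] [Fintype M] [DecidableEq N] [DecidableEq M] {S : Setting N M}

/-- `f` changes under adjacent swaps only by moving probability from the first to the second of the
swapped objects, and if it changes, then by at least `δ`. -/
def Mechanism.SwapsBy (δ : ℝ) (f : Mechanism S) : Prop :=
  ∀ (i : N) (t : N → Pref M) (t' : Pref M) (a b : M), (t i).IsAdjacentSwap t' a b →
    ∃ d : ℝ, (d = 0 ∨ δ ≤ d) ∧ ∀ j, (f t).prob i j - (f (Function.update t i t')).prob i j =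
      d * ((if j = a then 1 else 0) - if j = b then 1 else 0)

/-- It suffices to check the swaps on the way from a misreport to the truth. -/
theorem Mechanism.sum_nonneg_of_adjacentSwap (h : Mechanism S) (i : N) (t : N → Pref M) (u : M → ℝ)
    (hstep : ∀ (s s' : Pref M) (a b : M), s.IsAdjacentSwap s' a b → t i a < t i b →
      (∀ j, s a < s j → t i a < t i j) →
      0 ≤ ∑ j, u j * ((h (Function.update t i s)).prob i j -
        (h (Function.update t i s')).prob i j)) (s : Pref M) :
    0 ≤ ∑ j, u j * ((h t).prob i j - (h (Function.update t i s)).prob i j) := by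
  have hbound : ∀ s : Pref M, ∑ j, (s j : ℕ) * (t i j : ℕ) ≤
      Fintype.card M * (Fintype.card M * Fintype.card M) := fun s => by
    calc _ ≤ ∑ _j : M, Fintype.card M * Fintype.card M :=
          Finset.sum_le_sum fun j _ => Nat.mul_le_mul (s j).isLt.le (t i j).isLt.le
      _ = _ := by simp
  -- The sum of products of ranks grows along the path; subtracting it from a crude bound valid for
  -- all reports gives a decreasing natural number.
  induction hk : Fintype.card M * (Fintype.card M * Fintype.card M) -
      ∑ j, (s j : ℕ) * (t i j : ℕ) using Nat.strong_induction_on generalizing s with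
  | _ k ih =>
    by_cases hs : s = t i
    · simp [hs]
    · obtain ⟨s', a, b, hsw, hab, hbelow, hlt⟩ := Pref.exists_adjacentSwap_toward hs
      have h1 := ih _ (by have := hbound s'; omega) s' rfl
      have h2 := hstep s' s a b hsw hab hbelow
      have h3 := add_nonneg h1 h2
      rw [← Finset.sum_add_distrib] at h3
      refine h3.trans_eq (Finset.sum_congr rfl fun j _ => ?_)
      ring

/-- Allowing arbitrary weights `w` lets the same `d` serve both the utility itself and the utility
shifted by its minimum. -/
theorem Mechanism.SwapsBy.sum_mul {δ : ℝ} {f : Mechanism S} (hf : f.SwapsBy δ) (hδ : 0 ≤ δ) (i : N)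
    (t : N → Pref M) (s s' : Pref M) (a b : M) (hsw : s.IsAdjacentSwap s' a b) :
    ∃ d : ℝ, (d = 0 ∨ δ ≤ d) ∧ 0 ≤ d ∧
      ((f (Function.update t i s)).prob i ≠ (f (Function.update t i s')).prob i → d ≠ 0) ∧
      ∀ w : M → ℝ, ∑ j, w j * ((f (Function.update t i s)).prob i j -
        (f (Function.update t i s')).prob i j) = d * (w a - w b) := by
  obtain ⟨d, hd, hdf⟩ := hf i (Function.update t i s) s' a b (by simpa using hsw)
  simp only [Function.update_idem] at hdf
  refine ⟨d, hd, ?_, fun hne h0 => hne (funext fun j => ?_), fun w => ?_⟩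
  · rcases hd with h | h
    · exact h.ge
    · exact hδ.trans h
  · have := hdf j
    rw [h0, zero_mul] at this
    linarith
  · simp only [hdf]
    calc _ = ∑ j, ((if j = a then d * w j else 0) - if j = b then d * w j else 0) := by
          refine Finset.sum_congr rfl fun j _ => ?_
          split_ifs <;> ring
      _ = _ := by
          rw [Finset.sum_sub_distrib]
          simp only [Finset.sum_ite_eq', Finset.mem_univ, if_true]
          ring

theorem Mechanism.SwapsBy.strategyproof {δ : ℝ} {f : Mechanism S} (hf : f.SwapsBy δ)
    (hδ : 0 ≤ δ) : f.Strategyproof := by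
  intro i t t' u hu
  refine Mechanism.sum_nonneg_of_adjacentSwap _ i t u (fun s s' a b hsw hab _ => ?_) t'
  obtain ⟨d, -, hd0, -, hsum⟩ := hf.sum_mul hδ i t s s' a b hsw
  rw [hsum]
  exact mul_nonneg hd0 (sub_nonneg.2 ((hu a b).1 hab).le)

/-- For every bound `r < 1`, hybrids that put little weight on a weakly invariant and weakly less
varying mechanism are `URBI(r)`-partially strategyproof. -/
theorem Mechanism.SwapsBy.exists_hybrid {δ : ℝ} (hδ : 0 < δ) {f g : Mechanism S}
    (hf : f.SwapsBy δ) (hg : g.WeaklyInvariant) (hgf : g.WeaklyLessVarying f) {r : ℝ}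
    (hr : r ∈ Set.Ico (0 : ℝ) 1) :
    ∃ (β : ℝ) (hβ : β ∈ Set.Ioo (0 : ℝ) 1), Mechanism.PartiallyStrategyproof r
      (hybrid β (Set.Ioo_subset_Icc_self hβ) f g) := by
  obtain ⟨m, hm⟩ : ∃ m : ℝ, m = (Fintype.card M : ℝ) := ⟨_, rfl⟩
  have hm0 : 0 ≤ m := hm ▸ Nat.cast_nonneg _
  -- `c` is the guaranteed gain from `f` per unit of shifted utility of `a`, and `m` bounds the loss
  -- from `g` in the same unit. The weight `c / (c + m + 1)` makes the gain prevail; the `1` keeps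
  -- it below `1` even when `m = 0`.
  set c : ℝ := δ * (1 - r) with hc
  have hc0 : 0 < c := mul_pos hδ (sub_pos.2 hr.2)
  have hden : 0 < c + m + 1 := by linarith
  have hβ0 : 0 < c / (c + m + 1) := div_pos hc0 hden
  have hβ1 : c / (c + m + 1) < 1 := by
    rw [div_lt_one hden]
    linarith
  have hkey : c / (c + m + 1) * m ≤ (1 - c / (c + m + 1)) * c := by
    have : 1 - c / (c + m + 1) = (m + 1) / (c + m + 1) := by
      field_simp
      ring
    rw [this, div_mul_eq_mul_div, div_mul_eq_mul_div]
    rw [div_le_div_iff_of_pos_right hden]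
    nlinarith
  refine ⟨c / (c + m + 1), ⟨hβ0, hβ1⟩, ?_⟩
  generalize c / (c + m + 1) = β at *
  intro i t t' u hu hur
  refine Mechanism.sum_nonneg_of_adjacentSwap _ i t u (fun s s' a b hsw hab hbelow => ?_) t'
  obtain ⟨d, hd, hd0, hdne, hsum⟩ := hf.sum_mul hδ.le i t s s' a b hsw
  have hinv := hg i (Function.update t i s) s' a b (by simpa using hsw)
  have hless := hgf i (Function.update t i s) s' (by simpa using ⟨a, b, hsw⟩)
  simp only [Function.update_idem, Function.update_self] at hinv hless
  set x := f (Function.update t i s)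
  set x' := f (Function.update t i s')
  set y := g (Function.update t i s)
  set y' := g (Function.update t i s')
  -- Since rows sum to one, shifting the utility changes no expected difference; shifted by the
  -- minimum, it is nonnegative and URBI reads `w b ≤ r * w a`.
  set w : M → ℝ := fun j => u j - ⨅ c, u c with hw
  have hw0 : ∀ j, 0 ≤ w j := fun j => sub_nonneg.2 (ciInf_le (Set.finite_range u).bddBelow j)
  have huw : ∀ j, u j = w j + ⨅ c, u c := fun j => by simp [hw]
  have hab' : w b ≤ r * w a := hur a b ((hu a b).1 hab)
  have hfsum : ∑ j, w j * (x.prob i j - x'.prob i j) = d * (w a - w b) := hsum w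
  have htotal : ∑ j, u j * ((hybrid β (Set.Ioo_subset_Icc_self ⟨hβ0, hβ1⟩) f g
        (Function.update t i s)).prob i j - (hybrid β (Set.Ioo_subset_Icc_self ⟨hβ0, hβ1⟩) f g
        (Function.update t i s')).prob i j) =
      (1 - β) * (d * (w a - w b)) + β * ∑ j, w j * (y.prob i j - y'.prob i j) := by
    have hz : ∑ j, (((1 - β) * x.prob i j + β * y.prob i j) -
        ((1 - β) * x'.prob i j + β * y'.prob i j)) = 0 := by
      simp only [Finset.sum_sub_distrib, Finset.sum_add_distrib, ← Finset.mul_sum,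
        Allocation.fulfillment]
      ring
    rw [← hfsum]
    calc _ = ∑ j, (w j * (((1 - β) * x.prob i j + β * y.prob i j) -
            ((1 - β) * x'.prob i j + β * y'.prob i j)) + (⨅ c, u c) *
            (((1 - β) * x.prob i j + β * y.prob i j) -
            ((1 - β) * x'.prob i j + β * y'.prob i j))) := by
          refine Finset.sum_congr rfl fun j _ => ?_
          rw [huw j]
          simp only [hybrid, Allocation.mix]
          ring
      _ = _ := by
          rw [Finset.sum_add_distrib, ← Finset.mul_sum, hz, mul_zero, add_zero, Finset.mul_sum,
            Finset.mul_sum, ← Finset.sum_add_distrib]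
          exact Finset.sum_congr rfl fun j _ => by ring
  rw [htotal]
  have hwa := hw0 a
  have hwab : (1 - r) * w a ≤ w a - w b := by linarith
  have hwab0 : 0 ≤ w a - w b := (mul_nonneg (sub_nonneg.2 hr.2.le) hwa).trans hwab
  by_cases hy : y.prob i = y'.prob i
  · simp only [hy, sub_self, mul_zero, Finset.sum_const_zero, add_zero]
    exact mul_nonneg (sub_nonneg.2 hβ1.le) (mul_nonneg hd0 hwab0)
  · have hdδ : δ ≤ d := hd.resolve_left (hdne (hless hy))
    -- Objects above `a` contribute nothing by weak invariance. Each other object has `w j ≤ w a`,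
    -- by the choice of the path, and its probability changes by at most one.
    have hgsum : -(m * w a) ≤ ∑ j, w j * (y.prob i j - y'.prob i j) := by
      calc -(m * w a) = ∑ _j : M, -w a := by simp [hm]
        _ ≤ _ := by
          refine Finset.sum_le_sum fun j _ => ?_
          rcases lt_trichotomy (s j) (s a) with hj | hj | hj
          · rw [hinv j hj, sub_self, mul_zero]
            linarith
          · rw [s.injective hj]
            have h1 := (y.mem_Icc i a).1
            have h2 := (y'.mem_Icc i a).2
            nlinarith
          · have h1 := (y.mem_Icc i j).1
            have h2 := (y'.mem_Icc i j).2
            have h3 : w j ≤ w a := by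
              have := (hu a j).1 (hbelow j hj)
              simp only [hw]
              linarith
            have h4 := hw0 j
            nlinarith
    have h1 : δ * ((1 - r) * w a) ≤ d * (w a - w b) :=
      mul_le_mul hdδ hwab (mul_nonneg (sub_nonneg.2 hr.2.le) hwa) hd0
    have h2 := mul_le_mul_of_nonneg_left h1 (sub_nonneg.2 hβ1.le)
    have h3 := mul_le_mul_of_nonneg_left hgsum hβ0.le
    have h4 := mul_le_mul_of_nonneg_right hkey hwa
    have h5 : (1 - β) * (δ * ((1 - r) * w a)) = (1 - β) * c * w a := by
      rw [hc]
      ring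
    nlinarith

end HybridIncentives

/-! ### Random Serial Dictatorship under swaps, and orderings that exhaust prescribed objects -/

section SerialDictatorship

variable {N M : Type*} [Fintype N] [Fintype M]

/-- The objects that remain for an agent do not depend on its own report. -/
theorem remainingCap_update [DecidableEq N] (S : Setting N M) (t : N → Pref M)
    (π : Fin (Fintype.card N) ≃ N) (i : N) (t' : Pref M) (k : ℕ) (hk : k ≤ π.symm i) :
    remainingCap S (Function.update t i t') π k = remainingCap S t π k := by
  induction k with
  | zero => rfl
  | succ k ih =>
    ext j
    have hne : ∀ h : k < Fintype.card N, π ⟨k, h⟩ ≠ i := by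
      rintro h rfl
      simp at hk
    simp only [remainingCap, ih (by omega)]
    congr 1
    refine propext (exists_congr fun h => ?_)
    rw [Function.update_of_ne (hne h), ih (by omega)]

open Classical in
/-- An adjacent swap matters in a serial dictatorship only if the first of the swapped objects is
the best remaining one and the second one also remains. -/
theorem serialDictatorship_swap [DecidableEq N] [DecidableEq M] (S : Setting N M) (t : N → Pref M)
    (π : Fin (Fintype.card N) ≃ N) {i : N} {t' : Pref M} {a b : M}
    (h : (t i).IsAdjacentSwap t' a b) (j : M) :
    serialDictatorship S t π i j - serialDictatorship S (Function.update t i t') π i j =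
      (if IsFavorite (t i) {a | 0 < remainingCap S t π (π.symm i) a} a ∧
          0 < remainingCap S t π (π.symm i) b then 1 else 0) *
        ((if j = a then 1 else 0) - if j = b then 1 else 0) := by
  unfold serialDictatorship
  rw [remainingCap_update S t π i t' _ le_rfl, Function.update_self]
  generalize hA : ({a | 0 < remainingCap S t π (π.symm i) a} : Set M) = A
  have hb : 0 < remainingCap S t π (π.symm i) b ↔ b ∈ A := by rw [← hA]; rfl
  simp only [hb]
  by_cases hc : IsFavorite (t i) A a ∧ b ∈ A
  · have h1 : IsFavorite (t i) A j ↔ j = a := ⟨fun hj => hj.eq hc.1, fun hj => hj ▸ hc.1⟩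
    have hb' := h.isFavorite_right hc.1 hc.2
    have h2 : IsFavorite t' A j ↔ j = b := ⟨fun hj => hj.eq hb', fun hj => hj ▸ hb'⟩
    simp only [h1, h2, if_pos hc, one_mul]
  · simp [h.isFavorite_iff hc, if_neg hc]

/-- The mass moved is the fraction of orderings in which the swap matters; a nonempty set of
orderings has fraction at least `1/n!`. -/
theorem RSD_swapsBy [DecidableEq N] [DecidableEq M] (S : Setting N M) :
    (RSD S).SwapsBy (1 / (Fintype.card N).factorial) := by
  classical
  intro i t t' a b h
  set D : Finset (Fin (Fintype.card N) ≃ N) := Finset.univ.filter fun π =>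
    IsFavorite (t i) {a | 0 < remainingCap S t π (π.symm i) a} a ∧
      0 < remainingCap S t π (π.symm i) b with hD
  refine ⟨(D.card : ℝ) / (Fintype.card N).factorial, ?_, fun j => ?_⟩
  · rcases Nat.eq_zero_or_pos D.card with h0 | h0
    · left
      simp [h0]
    · right
      gcongr
      exact_mod_cast h0
  · simp only [RSD]
    rw [← sub_div, ← Finset.sum_sub_distrib,
      Finset.sum_congr rfl fun π _ => serialDictatorship_swap S t π h j, ← Finset.sum_mul,
      Finset.sum_boole, div_mul_eq_mul_div]

/-- If in some ordering the first of the swapped objects is the best remaining one and the second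
one also remains, then an adjacent swap changes the outcome of Random Serial Dictatorship. -/
theorem RSD_ne_of_swap [DecidableEq N] [DecidableEq M] (S : Setting N M) (t : N → Pref M)
    (π : Fin (Fintype.card N) ≃ N) {i : N} {t' : Pref M} {a b : M}
    (h : (t i).IsAdjacentSwap t' a b)
    (ha : IsFavorite (t i) {a | 0 < remainingCap S t π (π.symm i) a} a)
    (hb : 0 < remainingCap S t π (π.symm i) b) :
    (RSD S t).prob i ≠ (RSD S (Function.update t i t')).prob i := by
  classical
  intro he
  have hpos : (0 : ℝ) < (Fintype.card N).factorial := by exact_mod_cast Nat.factorial_pos _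
  have h1 := congrFun he a
  simp only [RSD] at h1
  rw [div_left_inj' hpos.ne'] at h1
  refine absurd h1 (ne_of_gt (Finset.sum_lt_sum (fun ρ _ => ?_) ⟨π, Finset.mem_univ _, ?_⟩))
  · rw [← sub_nonneg, serialDictatorship_swap S t ρ h a]
    simp only [if_true, if_neg h.ne, sub_zero, mul_one]
    split_ifs <;> norm_num
  · rw [← sub_pos, serialDictatorship_swap S t π h a]
    simp [if_neg h.ne, ha, hb]

/-- There is an ordering of the agents along which a given priority is monotone. -/
theorem exists_monotone_ordering (p : N → ℕ) :
    ∃ π : Fin (Fintype.card N) ≃ N, Monotone (fun k => p (π k)) :=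
  ⟨(Tuple.sort (p ∘ (Fintype.equivFin N).symm)).trans (Fintype.equivFin N).symm,
    Tuple.monotone_sort (p ∘ (Fintype.equivFin N).symm)⟩

/-- Suppose that `F` assigns the copies of the objects in `E` to different agents other than `i`,
such that an agent to whom a copy of `j` is assigned prefers to `j` only objects in `E` that come
before `j` with respect to `e`. Then there is an ordering of the agents in which exactly the objects
in `E` are exhausted when it is the turn of `i`. -/
theorem exists_ordering_exhausting (S : Setting N M) (t : N → Pref M) (E : Set M) (e : M → ℕ)
    (F : (Σ j : E, Fin (S.cap j)) → N) (hF : Function.Injective F) (i : N) (hi : ∀ x, F x ≠ i)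
    (h : ∀ x, ∀ j', t (F x) j' < t (F x) x.1 → j' ∈ E ∧ e j' < e x.1) :
    ∃ π : Fin (Fintype.card N) ≃ N,
      ∀ j, 0 < remainingCap S t π (π.symm i) j ↔ j ∉ E ∧ 0 < S.cap j := by
  classical
  set K := ∑ j, e j with hK
  have heK : ∀ j, e j ≤ K := fun j =>
    Finset.single_le_sum (f := e) (fun _ _ => Nat.zero_le _) (Finset.mem_univ j)
  -- Agents holding a copy are ranked by `e` of their object. As `K` bounds `e`, agent `i` comes
  -- after all of them and before everyone else.
  set p : N → ℕ := fun v => if hv : ∃ x, F x = v then e hv.choose.1 else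
    if v = i then K + 1 else K + 2 with hp
  have pF : ∀ x, p (F x) = e x.1 := by
    intro x
    have hx : ∃ y, F y = F x := ⟨x, rfl⟩
    simp only [hp]
    rw [dif_pos hx, hF hx.choose_spec]
  have pi : p i = K + 1 := by
    simp only [hp]
    rw [dif_neg (by rintro ⟨x, hx⟩; exact hi x hx)]
    simp
  have pother : ∀ v, (∀ x, F x ≠ v) → v ≠ i → p v = K + 2 := by
    intro v hv hvi
    simp only [hp]
    rw [dif_neg (by rintro ⟨x, hx⟩; exact hv x hx), if_neg hvi]
  obtain ⟨π, hπ⟩ := exists_monotone_ordering p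
  have hlt : ∀ v w, p v < p w → π.symm v < π.symm w := by
    intro v w hvw
    by_contra hc
    have := hπ (not_lt.1 hc)
    simp only [Equiv.apply_symm_apply] at this
    omega
  have hbefore : ∀ v, π.symm v < π.symm i → ∃ x, F x = v := by
    intro v hv
    by_contra hc
    push Not at hc
    have hvi : v ≠ i := by
      rintro rfl
      exact lt_irrefl _ hv
    have := hlt i v (by rw [pi, pother v hc hvi]; omega)
    exact lt_asymm this hv
  have hFi : ∀ x, π.symm (F x) < π.symm i := fun x =>
    hlt _ _ (by rw [pF, pi]; have := heK x.1; omega)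
  have sdF : ∀ x j, IsFavorite (t (F x)) {a | 0 < remainingCap S t π (π.symm (F x)) a} x.1 →
      serialDictatorship S t π (F x) j = if j = x.1 then 1 else 0 := by
    intro x j hx
    unfold serialDictatorship
    congr 1
    exact propext ⟨fun hj => hj.eq hx, fun hj => hj ▸ hx⟩
  -- Only holders move before `i`. As long as each picks its assigned object, the copies gone are
  -- exactly those whose holder has moved.
  have hcount : ∀ k : Fin (Fintype.card N), k ≤ π.symm i →
      (∀ x, π.symm (F x) < k →
        IsFavorite (t (F x)) {a | 0 < remainingCap S t π (π.symm (F x)) a} x.1) →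
      ∀ j, (remainingCap S t π k j : ℝ) +
        ∑ x, (if π.symm (F x) < k ∧ j = x.1 then (1 : ℝ) else 0) = S.cap j := by
    intro k hk hx j
    rw [← (remainingCap_sum S t π k k.isLt.le).2 j]
    congr 1
    have : ∀ v ∉ Finset.univ.image F, (if ((π.symm v : Fin _) : ℕ) < k then
        serialDictatorship S t π v j else 0) = 0 := by
      intro v hv
      refine if_neg fun hvk => hv ?_
      obtain ⟨x, rfl⟩ := hbefore v (lt_of_lt_of_le hvk hk)
      exact Finset.mem_image_of_mem _ (Finset.mem_univ x)
    rw [← Finset.sum_subset (Finset.subset_univ _) fun v _ hv => this v hv,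
      Finset.sum_image fun x _ y _ hxy => hF hxy]
    refine Finset.sum_congr rfl fun x _ => ?_
    by_cases hlt : π.symm (F x) < k
    · rw [if_pos (show ((π.symm (F x) : Fin _) : ℕ) < k from hlt), sdF x j (hx x hlt)]
      simp [hlt]
    · rw [if_neg (show ¬ ((π.symm (F x) : Fin _) : ℕ) < k from hlt), if_neg (by simp [hlt])]
  have hcopies : ∀ j : E, ∑ x : (Σ j : E, Fin (S.cap j)), (if (j : M) = x.1 then (1 : ℝ) else 0) =
      S.cap j := by
    intro j
    rw [Fintype.sum_sigma]
    simp only [Finset.sum_const, Finset.card_univ, Fintype.card_fin, nsmul_eq_mul, mul_ite, mul_one,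
      mul_zero, ← Subtype.ext_iff]
    simp
  have hexh : ∀ k : Fin (Fintype.card N), k ≤ π.symm i →
      (∀ x, π.symm (F x) < k →
        IsFavorite (t (F x)) {a | 0 < remainingCap S t π (π.symm (F x)) a} x.1) →
      ∀ j : E, (∀ x, x.1 = j → π.symm (F x) < k) → remainingCap S t π k j = 0 := by
    intro k hk hx j hj
    have h1 := hcount k hk hx j
    have h2 : ∑ x, (if π.symm (F x) < k ∧ (j : M) = x.1 then (1 : ℝ) else 0) = S.cap j := by
      rw [← hcopies j]
      refine Finset.sum_congr rfl fun x _ => ?_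
      congr 1
      exact propext ⟨fun hh => hh.2, fun hh => ⟨hj x (Subtype.ext hh.symm), hh⟩⟩
    rw [h2] at h1
    have : (remainingCap S t π k j : ℝ) = 0 := by linarith
    exact_mod_cast this
  -- Every agent to whom a copy is assigned picks this object.
  have hpick : ∀ k : ℕ, ∀ x, (π.symm (F x) : ℕ) = k →
      IsFavorite (t (F x)) {a | 0 < remainingCap S t π (π.symm (F x)) a} x.1 := by
    intro k
    induction k using Nat.strong_induction_on with
    | _ k ih =>
      rintro x rfl
      have ih' : ∀ y, π.symm (F y) < π.symm (F x) →
          IsFavorite (t (F y)) {a | 0 < remainingCap S t π (π.symm (F y)) a} y.1 :=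
        fun y hy => ih _ hy y rfl
      refine ⟨?_, fun j' hj' => ?_⟩
      -- The copy held by `F x` itself has not been taken yet, so strictly fewer than all copies are
      -- gone.
      · have h1 := hcount _ (hFi x).le ih' x.1
        have h2 : ∑ y, (if π.symm (F y) < π.symm (F x) ∧ (x.1 : M) = y.1 then (1 : ℝ) else 0) <
            S.cap x.1 := by
          rw [← hcopies x.1]
          refine Finset.sum_lt_sum (fun y _ => ?_) ⟨x, Finset.mem_univ x, by simp⟩
          split_ifs with h3 h4
          · exact le_rfl
          · exact absurd h3.2 h4
          · exact zero_le_one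
          · exact le_rfl
        have h3 : (0 : ℝ) < remainingCap S t π (π.symm (F x)) x.1 := by linarith
        exact_mod_cast h3
      -- A better object lies in `E` with smaller `e`, so all holders of its copies have moved and
      -- it is exhausted.
      · by_contra hc
        obtain ⟨hE, he⟩ := h x j' (not_le.1 hc)
        have h0 := hexh _ (hFi x).le ih' ⟨j', hE⟩ fun y hy => by
          refine hlt _ _ ?_
          rw [pF, pF, hy]
          exact he
        simp only [Set.mem_ofPred_eq] at hj'
        simp only at h0
        omega
  refine ⟨π, fun j => ?_⟩
  have hall : ∀ x, π.symm (F x) < π.symm i →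
      IsFavorite (t (F x)) {a | 0 < remainingCap S t π (π.symm (F x)) a} x.1 :=
    fun x _ => hpick _ x rfl
  by_cases hj : j ∈ E
  · have := hexh _ le_rfl hall ⟨j, hj⟩ fun x _ => hFi x
    simp only at this
    simp [this, hj]
  · have h1 := hcount _ le_rfl hall j
    have h2 : ∀ x : (Σ j : E, Fin (S.cap j)), ¬ (π.symm (F x) < π.symm i ∧ j = x.1) := by
      rintro x ⟨-, rfl⟩
      exact hj x.1.2
    simp only [h2, if_false, Finset.sum_const_zero, add_zero] at h1
    have h3 : remainingCap S t π (π.symm i) j = S.cap j := by exact_mod_cast h1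
    simp [h3, hj]

end SerialDictatorship

/-! ### The simultaneous eating algorithm -/

section Eating

variable {N M : Type*} [Fintype N] [Fintype M]

theorem EatingState.step_congr {t t' : N → Pref M} {s : EatingState N M}
    (h : ∀ v j, IsFavorite (t v) s.available j ↔ IsFavorite (t' v) s.available j) :
    s.step t = s.step t' := by
  classical
  have he : ∀ j, s.eaters t j = s.eaters t' j := fun j => by
    unfold EatingState.eaters
    ext v
    simp [h]
  have hl : s.stepLength t = s.stepLength t' := by
    unfold EatingState.stepLength
    simp only [he]
  unfold EatingState.step
  simp only [he, hl, h]

theorem eatingState_zero (S : Setting N M) (t : N → Pref M) :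
    eatingState S t 0 = EatingState.init S := rfl

/-- Steps after time `1` have length zero. Comparisons of two runs can thus be limited to states
before time `1`, where the Hall argument applies. -/
theorem EatingState.Valid.step_of_time_eq {S : Setting N M} {s : EatingState N M} (hs : s.Valid S)
    (h : s.time = 1) (t : N → Pref M) : s.step t = s := by
  have h0 : s.stepLength t = 0 := by
    have h1 := EatingState.stepLength_nonneg t hs
    have h2 := s.stepLength_le t
    linarith
  unfold EatingState.step
  simp [h0]

theorem eatingState_available_antitone (S : Setting N M) (t : N → Pref M) :
    Antitone fun k => (eatingState S t k).available := by
  refine antitone_nat_of_succ_le fun k j hj => ?_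
  have h := EatingState.stepLength_nonneg t (eatingState_valid S t k)
  simp only [eatingState_succ] at hj
  have h1 : (0 : ℝ) < (eatingState S t k).rem j - ((eatingState S t k).eaters t j).card *
    (eatingState S t k).stepLength t := hj
  have h2 : (0 : ℝ) ≤ ((eatingState S t k).eaters t j).card * (eatingState S t k).stepLength t :=
    mul_nonneg (Nat.cast_nonneg _) h
  have h3 : (0 : ℝ) < (eatingState S t k).rem j := by linarith
  exact h3

theorem eatingState_share_mono (S : Setting N M) (t : N → Pref M) (v : N) (j : M) :
    Monotone fun k => (eatingState S t k).share v j := by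
  refine monotone_nat_of_le_succ fun k => ?_
  have h := EatingState.stepLength_nonneg t (eatingState_valid S t k)
  rw [eatingState_succ]
  simp only [EatingState.step]
  split_ifs <;> linarith

theorem EatingState.share_step_of_not_isFavorite (t : N → Pref M) {s : EatingState N M} {v : N}
    {j : M}
    (hj : ¬ IsFavorite (t v) s.available j) : (s.step t).share v j = s.share v j := by
  simp [EatingState.step, hj]

/-- An agent eats only from objects that are its favorite at some step. -/
theorem eatingState_exists_isFavorite {S : Setting N M} {t : N → Pref M} {k : ℕ} {v : N} {j : M}
    (h : (eatingState S t k).share v j ≠ 0) :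
    ∃ l < k, IsFavorite (t v) (eatingState S t l).available j := by
  induction k with
  | zero => exact absurd rfl h
  | succ k ih =>
    by_cases hf : IsFavorite (t v) (eatingState S t k).available j
    · exact ⟨k, Nat.lt_succ_self k, hf⟩
    · rw [eatingState_succ, EatingState.share_step_of_not_isFavorite t hf] at h
      obtain ⟨l, hl, hl'⟩ := ih h
      exact ⟨l, by omega, hl'⟩

theorem IsFavorite.not_mem {t : Pref M} {A : Set M} {j l : M} (h : IsFavorite t A j)
    (hl : t l < t j) : l ∉ A := fun hA => absurd hl (not_lt.2 (h.2 l hA))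

/-! ### Weak invariance of PS, and the embedding of eating states into serial dictatorships -/

section Swap

variable [DecidableEq N] [DecidableEq M]

theorem Pref.IsAdjacentSwap.step_eq {t : N → Pref M} {i : N} {t' : Pref M} {a b : M}
    (h : (t i).IsAdjacentSwap t' a b) {s : EatingState N M}
    (hs : ¬ (IsFavorite (t i) s.available a ∧ b ∈ s.available)) :
    s.step (Function.update t i t') = s.step t := by
  refine EatingState.step_congr fun v j => ?_
  by_cases hv : v = i
  · subst hv
    rw [Function.update_self]
    exact h.isFavorite_iff hs j
  · rw [Function.update_of_ne hv]

/-- The two runs agree until a state in which `a` is the agent's favorite and `b` is available. By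
then every object above `a` is exhausted, so its share is frozen in both runs. -/
theorem PS_weaklyInvariant (S : Setting N M) : (PS S).WeaklyInvariant := by
  intro i t t' a b h j hj
  have hk : ∀ k, eatingState S (Function.update t i t') k = eatingState S t k ∨
      (j ∉ (eatingState S t k).available ∧
        j ∉ (eatingState S (Function.update t i t') k).available ∧
        (eatingState S t k).share i j =
          (eatingState S (Function.update t i t') k).share i j) := by
    have hpersist : ∀ t k, j ∉ (eatingState S t k).available →
        j ∉ (eatingState S t (k + 1)).available ∧
          (eatingState S t (k + 1)).share i j = (eatingState S t k).share i j := by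
      intro t k h1
      refine ⟨fun hh => h1 (eatingState_available_antitone S t (Nat.le_succ k) hh), ?_⟩
      rw [eatingState_succ, EatingState.share_step_of_not_isFavorite _ fun hf => h1 hf.1]
    intro k
    induction k with
    | zero => exact Or.inl (by rw [eatingState_zero, eatingState_zero])
    | succ k ih =>
      have key : j ∉ (eatingState S t k).available →
          j ∉ (eatingState S (Function.update t i t') k).available →
          (eatingState S t k).share i j = (eatingState S (Function.update t i t') k).share i j →
          j ∉ (eatingState S t (k + 1)).available ∧
          j ∉ (eatingState S (Function.update t i t') (k + 1)).available ∧
          (eatingState S t (k + 1)).share i j =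
            (eatingState S (Function.update t i t') (k + 1)).share i j := by
        intro h1 h2 h3
        obtain ⟨h4, h5⟩ := hpersist _ k h1
        obtain ⟨h6, h7⟩ := hpersist _ k h2
        exact ⟨h4, h6, by rw [h5, h7, h3]⟩
      rcases ih with he | ⟨h1, h2, h3⟩
      · by_cases hc : IsFavorite (t i) (eatingState S t k).available a ∧
            b ∈ (eatingState S t k).available
        · have hja := hc.1.not_mem hj
          exact Or.inr (key hja (by rwa [he]) (by rw [he]))
        · left
          rw [eatingState_succ, eatingState_succ, he, h.step_eq hc]
      · exact Or.inr (key h1 h2 h3)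
  have hprob : ∀ t, (PS S t).prob = (eatingState S t (Fintype.card M)).share := fun t => rfl
  rw [hprob, hprob]
  rcases hk (Fintype.card M) with h1 | h1
  · rw [h1]
  · exact h1.2.2

/-- At every time before `1`, the copies of the exhausted objects can be assigned to different
agents other than `i` who have eaten from these objects. -/
theorem EatingState.Valid.exists_assignment {S : Setting N M} {s : EatingState N M}
    (hs : s.Valid S) (h1 : s.time < 1) (i : N) :
    ∃ F : (Σ j : {j | j ∉ s.available}, Fin (S.cap j)) → N, Function.Injective F ∧
      ∀ x, F x ≠ i ∧ s.share (F x) x.1 ≠ 0 := by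
  classical
  set T : (Σ j : {j | j ∉ s.available}, Fin (S.cap j)) → Finset N := fun x =>
    Finset.univ.filter fun v => v ≠ i ∧ s.share v x.1 ≠ 0 with hT
  -- Hall's condition: for the set `J` of objects occurring in `A`, all their units were eaten by
  -- the agents in `B`, and excluding `i` costs at most one agent.
  have hall : ∀ A : Finset (Σ j : {j | j ∉ s.available}, Fin (S.cap j)),
      A.card ≤ (A.biUnion T).card := by
    intro A
    set J := A.image Sigma.fst with hJ
    set B : Finset N := Finset.univ.filter fun v => ∃ j ∈ J, s.share v j ≠ 0 with hB
    have hA : A.card ≤ ∑ j ∈ J, S.cap j := by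
      calc A.card ≤ (J.sigma fun j => (Finset.univ : Finset (Fin (S.cap j)))).card := by
            refine Finset.card_le_card fun x hx => ?_
            exact Finset.mem_sigma.2 ⟨Finset.mem_image_of_mem Sigma.fst hx, Finset.mem_univ _⟩
        _ = _ := by simp only [Finset.card_sigma, Finset.card_univ, Fintype.card_fin]
    have hsum : ((∑ j ∈ J, S.cap j : ℕ) : ℝ) = ∑ v ∈ B, ∑ j ∈ J, s.share v j := by
      have hcap : ∀ j : {j | j ∉ s.available}, (S.cap j : ℝ) = ∑ v, s.share v j := by
        intro j
        have h0 : s.rem j = 0 := le_antisymm (not_lt.1 j.2) (hs.rem_nonneg j)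
        rw [← hs.rem_add, h0, zero_add]
      push_cast
      rw [Finset.sum_congr rfl fun j _ => hcap j, Finset.sum_comm]
      refine (Finset.sum_subset (Finset.subset_univ _) fun v _ hv => ?_).symm
      refine Finset.sum_eq_zero fun j hj => ?_
      by_contra hne
      exact hv (Finset.mem_filter.2 ⟨Finset.mem_univ v, j, hj, hne⟩)
    have hBle : B.card ≤ (A.biUnion T).card + 1 := by
      calc B.card ≤ (insert i (A.biUnion T)).card := by
            refine Finset.card_le_card fun v hv => ?_
            obtain ⟨-, j, hj, hne⟩ := Finset.mem_filter.1 hv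
            obtain ⟨x, hx, rfl⟩ := Finset.mem_image.1 hj
            by_cases hvi : v = i
            · simp [hvi]
            · refine Finset.mem_insert_of_mem (Finset.mem_biUnion.2 ⟨x, hx, ?_⟩)
              simp [hT, hvi, hne]
        _ ≤ _ := Finset.card_insert_le _ _
    have hrow : ∀ v, ∑ j ∈ J, s.share v j ≤ s.time := by
      intro v
      rw [← hs.sum_share v]
      calc ∑ j ∈ J, s.share v j = ∑ j ∈ J.image Subtype.val, s.share v j := by
            rw [Finset.sum_image fun x _ y _ hxy => Subtype.ext hxy]
        _ ≤ _ := Finset.sum_le_sum_of_subset_of_nonneg (Finset.subset_univ _)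
            fun j _ _ => hs.share_nonneg v j
    -- Each agent in `B` has eaten at most `s.time < 1`, so the total capacity is strictly below the
    -- size of `B`; by integrality, this slack pays for excluding `i`.
    have hlt : (∑ j ∈ J, S.cap j) = 0 ∨ (∑ j ∈ J, S.cap j) < B.card := by
      rcases Finset.eq_empty_or_nonempty B with h0 | h0
      · left
        rw [h0, Finset.sum_empty] at hsum
        exact_mod_cast hsum
      · right
        have hc : (0 : ℝ) < B.card := by exact_mod_cast h0.card_pos
        have h2 : ∑ v ∈ B, ∑ j ∈ J, s.share v j ≤ B.card * s.time := by
          calc _ ≤ ∑ _v ∈ B, s.time := Finset.sum_le_sum fun v _ => hrow v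
            _ = _ := by simp
        have h3 : ((∑ j ∈ J, S.cap j : ℕ) : ℝ) < B.card := by
          rw [hsum]
          refine h2.trans_lt ?_
          nlinarith
        exact_mod_cast h3
    omega
  obtain ⟨F, hF, hFT⟩ := (Finset.all_card_le_biUnion_card_iff_exists_injective T).1 hall
  refine ⟨F, hF, fun x => ?_⟩
  have := hFT x
  simpa [hT] using this

/-- For every agent and every state of the eating algorithm before time `1`, there is an ordering
in which the same objects remain in the serial dictatorship when it is the turn of this agent. -/
theorem exists_ordering_of_eatingState (S : Setting N M) (t : N → Pref M) (i : N) {k : ℕ}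
    (h1 : (eatingState S t k).time < 1) :
    ∃ π : Fin (Fintype.card N) ≃ N,
      ({a | 0 < remainingCap S t π (π.symm i) a} : Set M) = (eatingState S t k).available := by
  classical
  have hv := eatingState_valid S t k
  obtain ⟨F, hF, hF'⟩ := hv.exists_assignment h1 i
  -- The function `e` counts the steps before `k` at which an object is available. When an agent ate
  -- from its object, everything it prefers was already gone, and so has a smaller count.
  obtain ⟨π, hπ⟩ := exists_ordering_exhausting S t {j | j ∉ (eatingState S t k).available}
    (fun j => ((Finset.range k).filter fun l => j ∈ (eatingState S t l).available).card) F hF i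
    (fun x => (hF' x).1) fun x j' hj' => by
      obtain ⟨l, hl, hfav⟩ := eatingState_exists_isFavorite (hF' x).2
      have hanti := eatingState_available_antitone S t
      have hnot : ∀ l', l ≤ l' → j' ∉ (eatingState S t l').available := fun l' hl' hh =>
        hfav.not_mem hj' (hanti hl' hh)
      refine ⟨hnot k hl.le, Finset.card_lt_card ?_⟩
      rw [Finset.ssubset_iff_of_subset]
      · refine ⟨l, ?_, ?_⟩
        · simpa [hl] using hfav.1
        · simpa [hl] using hnot l le_rfl
      · intro l' hl'
        rw [Finset.mem_filter] at hl' ⊢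
        refine ⟨hl'.1, hanti (?_ : l' ≤ l) hfav.1⟩
        by_contra hc
        exact hnot l' (not_le.1 hc).le hl'.2
  refine ⟨π, Set.ext fun j => ?_⟩
  have := hπ j
  simp only [Set.mem_ofPred_eq, not_not] at this ⊢
  rw [this]
  refine ⟨fun hh => hh.1, fun hh => ⟨hh, ?_⟩⟩
  have hpos : 0 < (eatingState S t k).rem j := hh
  have hc : (0 : ℝ) < S.cap j := by
    rw [← hv.rem_add]
    exact add_pos_of_pos_of_nonneg hpos (Finset.sum_nonneg fun v _ => hv.share_nonneg v j)
  exact_mod_cast hc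

/-- If the runs differ, some state before time `1` has `a` as favorite and `b` available. An
ordering with the same remaining objects for `i` then shows that RSD changes as well. -/
theorem PS_weaklyLessVarying (S : Setting N M) : (PS S).WeaklyLessVarying (RSD S) := by
  rintro i t t' ⟨a, b, h⟩ hne
  obtain ⟨k, hk1, hka, hkb⟩ : ∃ k, (eatingState S t k).time < 1 ∧
      IsFavorite (t i) (eatingState S t k).available a ∧ b ∈ (eatingState S t k).available := by
    by_contra hno
    push Not at hno
    have hstate : ∀ k, eatingState S (Function.update t i t') k = eatingState S t k := by
      intro k
      induction k with
      | zero => rw [eatingState_zero, eatingState_zero]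
      | succ k ih =>
        rw [eatingState_succ, eatingState_succ, ih]
        by_cases h1 : (eatingState S t k).time < 1
        · exact h.step_eq fun hc => hno k h1 hc.1 hc.2
        · have hv := eatingState_valid S t k
          have he := le_antisymm hv.time_le (not_lt.1 h1)
          rw [hv.step_of_time_eq he, hv.step_of_time_eq he]
    apply hne
    have hprob : ∀ t, (PS S t).prob = (eatingState S t (Fintype.card M)).share := fun t => rfl
    rw [hprob, hprob, hstate]
  obtain ⟨π, hπ⟩ := exists_ordering_of_eatingState S t i hk1
  rw [← hπ] at hka hkb
  exact RSD_ne_of_swap S t π h hka hkb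

end Swap

end Eating

/-! ### Ordinal efficiency of Probabilistic Serial -/

section Efficiency

variable {N M : Type*} [Fintype N] [Fintype M] {S : Setting N M}

/-- The objects down to and including `j` are those strictly above the next-ranked object. If `j` is
ranked last there is none, and the equal totals are needed instead. -/
theorem FOSD.sum_le {t : Pref M} {v w : M → ℝ} (h : FOSD t v w) (hsum : ∑ j, v j = ∑ j, w j)
    (j : M) : ∑ l ∈ Finset.univ.filter (fun l => t l ≤ t j), w l ≤
      ∑ l ∈ Finset.univ.filter (fun l => t l ≤ t j), v l := by
  classical
  by_cases hj : (t j : ℕ) + 1 < Fintype.card M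
  · have h1 := h (t.symm ⟨(t j : ℕ) + 1, hj⟩)
    have h2 : ∀ l, t l ≤ t j ↔ t.Prefers l (t.symm ⟨(t j : ℕ) + 1, hj⟩) := by
      intro l
      simp only [Pref.Prefers, Equiv.apply_symm_apply, Fin.lt_def, Fin.le_def]
      omega
    unfold upperWeight at h1
    simp only [h2]
    exact h1
  · have h2 : ∀ l, t l ≤ t j := by
      intro l
      rw [Fin.le_def]
      have := (t l).isLt
      omega
    simp [h2, hsum]

theorem FOSD.le_of_eq {t : Pref M} {v w : M → ℝ} (h : FOSD t v w) (hsum : ∑ j, v j = ∑ j, w j)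
    {j : M} (heq : ∀ l, t l < t j → v l = w l) : w j ≤ v j := by
  classical
  have h1 := h.sum_le hsum j
  have hsplit : ∀ x : M → ℝ, ∑ l ∈ Finset.univ.filter (fun l => t l ≤ t j), x l =
      x j + ∑ l ∈ Finset.univ.filter (fun l => t l < t j), x l := by
    intro x
    rw [← Finset.sum_insert (by simp)]
    refine Finset.sum_congr ?_ fun _ _ => rfl
    ext l
    simp only [Finset.mem_filter, Finset.mem_univ, true_and, Finset.mem_insert, le_iff_eq_or_lt,
      t.injective.eq_iff]
  rw [hsplit, hsplit, Finset.sum_congr rfl fun l hl => heq l (Finset.mem_filter.1 hl).2] at h1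
  linarith

/-- Probabilistic Serial is ordinally efficient: the allocations of the objects that are exhausted
coincide with those in any allocation that ordinally dominates it. -/
theorem OrdDominates.eq_PS_of_exhausted {t : N → Pref M} {x : Allocation S}
    (h : OrdDominates t x (PS S t)) {k : ℕ} (hk : k ≤ Fintype.card M) {j : M}
    (hj : j ∉ (eatingState S t k).available) (v : N) : x.prob v j = (PS S t).prob v j := by
  classical
  have hanti := eatingState_available_antitone S t
  induction k generalizing j v with
  -- Unavailable at the outset means zero capacity.
  | zero =>
    have hc : ¬ ((0 : ℝ) < S.cap j) := hj
    have hzero : ∀ z : Allocation S, z.prob v j = 0 := fun z =>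
      le_antisymm ((Finset.single_le_sum (f := fun v => z.prob v j)
        (fun v _ => (z.mem_Icc v j).1) (Finset.mem_univ v)).trans
        ((z.capacity j).trans (not_lt.1 hc))) (z.mem_Icc v j).1
    rw [hzero, hzero]
  | succ k ih =>
    -- An agent with a positive share of `j` had it as favorite at some step `l ≤ k`, when all
    -- better objects were exhausted. The allocations agree on those by induction, so dominance
    -- compares the entries at `j` directly.
    have hle : ∀ v, (PS S t).prob v j ≤ x.prob v j := by
      intro v
      by_cases h0 : (PS S t).prob v j = 0
      · rw [h0]
        exact (x.mem_Icc v j).1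
      · obtain ⟨l, -, hl⟩ := eatingState_exists_isFavorite h0
        have hlk : l ≤ k := by
          by_contra hc
          exact hj (hanti (by omega : k + 1 ≤ l) hl.1)
        refine (h v).le_of_eq (by rw [x.fulfillment, (PS S t).fulfillment]) fun l' hl' => ?_
        exact ih (by omega) (fun hh => hl.not_mem hl' (hanti hlk hh)) v
    have hv := eatingState_valid S t (Fintype.card M)
    have hrem : (eatingState S t (Fintype.card M)).rem j = 0 :=
      le_antisymm (not_lt.1 fun hh => hj (hanti hk hh)) (hv.rem_nonneg j)
    have hcap : ∑ v, (PS S t).prob v j = S.cap j := by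
      rw [← hv.rem_add j, hrem, zero_add]
      rfl
    -- PS already uses the full capacity of `j`, so no entrywise inequality can be strict.
    have hsum : ∑ v, (PS S t).prob v j = ∑ v, x.prob v j :=
      le_antisymm (Finset.sum_le_sum fun v _ => hle v) (hcap ▸ x.capacity j)
    exact ((Finset.sum_eq_sum_iff_of_le fun v _ => hle v).1 hsum v (Finset.mem_univ v)).symm

/-- If an object better than `b` is left at the end, the agent ate only objects better than `b`, and
its upper weight is the maximal value `1`. Otherwise all objects better than `b` are exhausted and
the allocations agree on them. -/
theorem OrdDominates.PS_dominates {t : N → Pref M} {x : Allocation S}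
    (h : OrdDominates t x (PS S t)) : OrdDominates t (PS S t) x := by
  classical
  intro v b
  unfold upperWeight
  by_cases hex : ∃ j, (t v).Prefers j b ∧ j ∈ (eatingState S t (Fintype.card M)).available
  · obtain ⟨j, hjb, hj⟩ := hex
    have hzero : ∀ l, ¬ (t v).Prefers l b → (PS S t).prob v l = 0 := by
      intro l hl
      by_contra hne
      obtain ⟨k, hk, hfav⟩ := eatingState_exists_isFavorite hne
      refine hfav.not_mem (lt_of_lt_of_le hjb (not_lt.1 hl)) ?_
      exact eatingState_available_antitone S t hk.le hj
    have h1 : ∑ l ∈ Finset.univ.filter (fun l => (t v).Prefers l b), (PS S t).prob v l = 1 := by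
      rw [← (PS S t).fulfillment v]
      refine Finset.sum_subset (Finset.subset_univ _) fun l _ hl => hzero l ?_
      simpa using hl
    rw [h1, ← x.fulfillment v]
    exact Finset.sum_le_sum_of_subset_of_nonneg (Finset.subset_univ _)
      fun l _ _ => (x.mem_Icc v l).1
  · push Not at hex
    refine (Finset.sum_congr rfl fun l hl => ?_).le
    exact h.eq_PS_of_exhausted le_rfl (hex l (Finset.mem_filter.1 hl).2) v

end Efficiency

/-! ### Dominance of hybrids over RSD -/

section HybridDominance

variable {N M : Type*} [Fintype N] [Fintype M] {S : Setting N M}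

theorem upperWeight_hybrid (β : ℝ) (hβ : β ∈ Set.Icc (0 : ℝ) 1) (f g : Mechanism S)
    (t : N → Pref M) (p : Pref M) (v : N) (b : M) :
    upperWeight p ((hybrid β hβ f g t).prob v) b =
      upperWeight p ((f t).prob v) b +
        β * (upperWeight p ((g t).prob v) b - upperWeight p ((f t).prob v) b) := by
  simp only [upperWeight, hybrid, Allocation.mix, Finset.sum_add_distrib, ← Finset.mul_sum]
  ring

/-- Upper weights are affine in `β`, so for `β > 0` a hybrid dominated by RSD forces PS to be
dominated by RSD. Efficiency of PS then reverses the comparison, for PS and hence for the hybrid. -/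
theorem hybrid_imperfectOrdDominates [DecidableEq N] (S : Setting N M) {β : ℝ}
    (hβ : β ∈ Set.Icc (0 : ℝ) 1) (hpos : 0 < β) :
    ImperfectOrdDominates (hybrid β hβ (RSD S) (PS S)) (RSD S) := by
  rintro t (h | h)
  · exact h
  · have h1 : OrdDominates t (RSD S t) (PS S t) := by
      intro v b
      have := h v b
      rw [upperWeight_hybrid] at this
      nlinarith
    intro v b
    have := h1.PS_dominates v b
    rw [upperWeight_hybrid]
    nlinarith

theorem hybrid_strictOrdDominates [DecidableEq N] (S : Setting N M) {β : ℝ}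
    (hβ : β ∈ Set.Icc (0 : ℝ) 1) (hpos : 0 < β) {t : N → Pref M}
    (h : StrictOrdDominates t (PS S t) (RSD S t)) :
    StrictOrdDominates t (hybrid β hβ (RSD S) (PS S) t) (RSD S t) := by
  obtain ⟨h1, v, b, h2⟩ := h
  refine ⟨fun v b => ?_, v, b, ?_⟩
  · have := h1 v b
    rw [upperWeight_hybrid]
    nlinarith
  · rw [upperWeight_hybrid]
    nlinarith

theorem PS_imperfectOrdDominates [DecidableEq N] (S : Setting N M) :
    ImperfectOrdDominates (PS S) (RSD S) := by
  rintro t (h | h)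
  · exact h
  · exact h.PS_dominates

end HybridDominance

/-! ### Evaluating RSD by counting orderings -/

section Computation

variable {N M : Type*} [Fintype N] [Fintype M]

/-- A version of `remainingCap` with constructive case distinctions. -/
def computeRemainingCap (cap : M → ℕ) (t : N → Pref M) (π : Fin (Fintype.card N) ≃ N) :
    ℕ → M → ℕ
  | 0 => cap
  | k + 1 => fun j =>
      if ∃ h : k < Fintype.card N, 0 < computeRemainingCap cap t π k j ∧
          ∀ l, 0 < computeRemainingCap cap t π k l → t (π ⟨k, h⟩) j ≤ t (π ⟨k, h⟩) l
      then computeRemainingCap cap t π k j - 1 else computeRemainingCap cap t π k j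

theorem remainingCap_eq_compute (S : Setting N M) (t : N → Pref M)
    (π : Fin (Fintype.card N) ≃ N) (k : ℕ) :
    remainingCap S t π k = computeRemainingCap S.cap t π k := by
  induction k with
  | zero => rfl
  | succ k ih =>
    ext j
    simp only [remainingCap, computeRemainingCap, ih, IsFavorite, Set.mem_ofPred_eq]

/-- Reduces an RSD probability to the cardinality of a decidable set of orderings, which the kernel
can evaluate. The decidability instance is left arbitrary so that a constructive one can be used. -/
theorem RSD_prob_eq_div [DecidableEq N] (S : Setting N M) (t : N → Pref M) (i : N) (j : M) {c : ℕ}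
    [DecidablePred fun π : Fin (Fintype.card N) ≃ N =>
      0 < computeRemainingCap S.cap t π (π.symm i) j ∧
        ∀ l, 0 < computeRemainingCap S.cap t π (π.symm i) l → t i j ≤ t i l]
    (h : (Finset.univ.filter fun π : Fin (Fintype.card N) ≃ N =>
      0 < computeRemainingCap S.cap t π (π.symm i) j ∧
        ∀ l, 0 < computeRemainingCap S.cap t π (π.symm i) l → t i j ≤ t i l).card = c) :
    (RSD S t).prob i j = (c : ℝ) / (Fintype.card N).factorial := by
  rw [← h, ← Finset.sum_boole]
  simp only [RSD, serialDictatorship, remainingCap_eq_compute, IsFavorite, Set.mem_ofPred_eq]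
  congr!

end Computation

/-! ### An instance where PS strictly dominates RSD -/

section Example

/-- Four agents, two objects of capacity one and one object of capacity two. -/
def fourAgentSetting : Setting (Fin 4) (Fin 3) where
  cap := ![1, 1, 2]
  supply := by decide

/-- All agents like object `2` least; the first two agents prefer object `0`, the other two agents
prefer object `1`. -/
def fourAgentProfile : Fin 4 → Pref (Fin 3) := fun i =>
  if i < 2 then finCongr (Fintype.card_fin 3).symm
  else (Equiv.swap 0 1).trans (finCongr (Fintype.card_fin 3).symm)

/-- The first choices in `fourAgentProfile`. -/
def fourAgentFirst : Fin 4 → Fin 3 := ![0, 0, 1, 1]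

theorem fourAgentProfile_RSD_first (i : Fin 4) :
    (RSD fourAgentSetting fourAgentProfile).prob i (fourAgentFirst i) = 10 / 24 := by
  have h : ∀ i, (Finset.univ.filter fun π : Fin (Fintype.card (Fin 4)) ≃ Fin 4 =>
      0 < computeRemainingCap fourAgentSetting.cap fourAgentProfile π (π.symm i)
        (fourAgentFirst i) ∧ ∀ l, 0 < computeRemainingCap fourAgentSetting.cap fourAgentProfile π
          (π.symm i) l → fourAgentProfile i (fourAgentFirst i) ≤ fourAgentProfile i l).card
        = 10 := by
    decide +kernel
  rw [RSD_prob_eq_div _ _ _ _ (h i)]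
  simp [Nat.factorial]

theorem fourAgentProfile_RSD_last (i : Fin 4) :
    (RSD fourAgentSetting fourAgentProfile).prob i 2 = 12 / 24 := by
  have h : ∀ i, (Finset.univ.filter fun π : Fin (Fintype.card (Fin 4)) ≃ Fin 4 =>
      0 < computeRemainingCap fourAgentSetting.cap fourAgentProfile π (π.symm i)
        2 ∧ ∀ l, 0 < computeRemainingCap fourAgentSetting.cap fourAgentProfile π
          (π.symm i) l → fourAgentProfile i 2 ≤ fourAgentProfile i l).card = 12 := by
    decide +kernel
  rw [RSD_prob_eq_div _ _ _ _ (h i)]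
  simp [Nat.factorial]

theorem fourAgentProfile_isFavorite (i : Fin 4) (j : Fin 3) :
    IsFavorite (fourAgentProfile i) Set.univ j ↔ j = fourAgentFirst i := by
  have h : ∀ i j, (∀ k, fourAgentProfile i j ≤ fourAgentProfile i k) ↔ j = fourAgentFirst i := by
    decide
  simp [IsFavorite, h]

/-- The first step suffices: each object has at least one unit and at most two eaters, so this step
lasts at least `1/2`, and shares never decrease. -/
theorem fourAgentProfile_PS_first (i : Fin 4) :
    1 / 2 ≤ (PS fourAgentSetting fourAgentProfile).prob i (fourAgentFirst i) := by
  classical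
  set s : EatingState (Fin 4) (Fin 3) := EatingState.init fourAgentSetting with hs
  have hrem : ∀ j, (1 : ℝ) ≤ s.rem j := by
    intro j
    have : ∀ j, 1 ≤ fourAgentSetting.cap j := by decide
    exact Nat.one_le_cast.2 (this j)
  have hav : s.available = Set.univ := Set.eq_univ_of_forall fun j => one_pos.trans_le (hrem j)
  have heat : ∀ j, (s.eaters fourAgentProfile j).card ≤ 2 := by
    intro j
    have h1 : ∀ j, (Finset.univ.filter fun i => j = fourAgentFirst i).card ≤ 2 := by decide
    refine le_trans (Finset.card_le_card fun i hi => ?_) (h1 j)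
    have h2 := (Finset.mem_filter.1 hi).2
    rw [hav, fourAgentProfile_isFavorite] at h2
    simp [h2]
  have hstep : 1 / 2 ≤ s.stepLength fourAgentProfile := by
    rcases s.stepLength_cases fourAgentProfile with h | ⟨j, hj, h⟩
    · rw [h, hs, EatingState.init]
      norm_num
    · rw [h]
      have hc : (0 : ℝ) < (s.eaters fourAgentProfile j).card := by exact_mod_cast hj.card_pos
      have hc2 : ((s.eaters fourAgentProfile j).card : ℝ) ≤ 2 := by exact_mod_cast heat j
      rw [div_le_div_iff₀ two_pos hc]
      linarith [hrem j]
  refine hstep.trans ?_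
  have h1 : (eatingState fourAgentSetting fourAgentProfile 1).share i (fourAgentFirst i) =
      s.stepLength fourAgentProfile := by
    rw [eatingState_succ, eatingState_zero]
    simp only [EatingState.step]
    rw [← hs, hav, if_pos ((fourAgentProfile_isFavorite i _).2 rfl)]
    simp [hs, EatingState.init]
  rw [← h1]
  exact eatingState_share_mono _ _ i _ (by simp : 1 ≤ Fintype.card (Fin 3))

theorem fourAgentProfile_upperWeight (i : Fin 4) (v : Fin 3 → ℝ) (b : Fin 3) :
    upperWeight (fourAgentProfile i) v b =
      if b = fourAgentFirst i then 0 else if b = 2 then v 0 + v 1 else v (fourAgentFirst i) := by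
  classical
  have h : ∀ i j b, (fourAgentProfile i).Prefers j b ↔
      b ≠ fourAgentFirst i ∧ (if b = 2 then j ≠ 2 else j = fourAgentFirst i) := by
    unfold Pref.Prefers
    decide
  unfold upperWeight
  simp only [h]
  by_cases h1 : b = fourAgentFirst i
  · simp [h1]
  · by_cases h2 : b = 2
    · simp [h2, Finset.sum_filter, Fin.sum_univ_three]
      aesop
    · simp [h1, h2, Finset.sum_filter]

/-- First choices improve from `10/24` to at least `1/2`. RSD gives weight `1/2` to the top two
objects together, which PS reaches with the first choice alone. -/
theorem fourAgentProfile_strictOrdDominates :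
    StrictOrdDominates fourAgentProfile (PS fourAgentSetting fourAgentProfile)
      (RSD fourAgentSetting fourAgentProfile) := by
  constructor
  · intro i b
    rw [fourAgentProfile_upperWeight, fourAgentProfile_upperWeight]
    have h1 := fourAgentProfile_PS_first i
    split_ifs
    · exact le_rfl
    · have h2 := (RSD fourAgentSetting fourAgentProfile).fulfillment i
      have h3 := fourAgentProfile_RSD_last i
      have h4 : ∀ i, fourAgentFirst i = 0 ∨ fourAgentFirst i = 1 := by decide
      have h5 := ((PS fourAgentSetting fourAgentProfile).mem_Icc i 0).1
      have h6 := ((PS fourAgentSetting fourAgentProfile).mem_Icc i 1).1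
      rw [Fin.sum_univ_three] at h2
      rcases h4 i with h | h <;> rw [h] at h1 <;> linarith
    · rw [fourAgentProfile_RSD_first]
      linarith
  · refine ⟨0, 1, ?_⟩
    have h1 := fourAgentProfile_PS_first 0
    rw [fourAgentProfile_upperWeight, fourAgentProfile_upperWeight]
    have h2 : (1 : Fin 3) ≠ fourAgentFirst 0 := by decide
    rw [if_neg h2, if_neg h2, if_neg (by decide), if_neg (by decide), fourAgentProfile_RSD_first]
    linarith

end Example

/-! ### Conclusions for the pair of RSD and PS -/

theorem RSD_PS_hybridAdmissible {N M : Type*} [Fintype N] [Fintype M] [DecidableEq N]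
    [DecidableEq M] (S : Setting N M) : HybridAdmissible (RSD S) (PS S) where
  strategyproof := (RSD_swapsBy S).strategyproof (by positivity)
  weaklyInvariant := PS_weaklyInvariant S
  weaklyLessVarying := PS_weaklyLessVarying S

theorem exists_hybrid_partiallyStrategyproof {N M : Type*} [Fintype N] [Fintype M] [DecidableEq N]
    [DecidableEq M] (S : Setting N M) {r : ℝ} (hr : r ∈ Set.Ico (0 : ℝ) 1) :
    ∃ (β : ℝ) (hβ : β ∈ Set.Ioo (0 : ℝ) 1), Mechanism.PartiallyStrategyproof r
      (hybrid β (Set.Ioo_subset_Icc_self hβ) (RSD S) (PS S)) :=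
  (RSD_swapsBy S).exists_hybrid (by positivity) (PS_weaklyInvariant S) (PS_weaklyLessVarying S) hr

end

theorem mainTheorem11 :
    (∀ {N : Type*} {M : Type*} [Fintype N] [Fintype M] [DecidableEq N] [DecidableEq M]
      (S : Setting N M),
      HybridAdmissible (RSD S) (PS S) ∧
      (∀ (β : ℝ) (hβ : β ∈ Set.Ioc (0 : ℝ) 1),
        ImperfectOrdDominates (hybrid β (Set.Ioc_subset_Icc_self hβ) (RSD S) (PS S)) (RSD S) ∧
        ((∃ t, StrictOrdDominates t (PS S t) (RSD S t)) →
          StrictImperfectOrdDominates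
            (hybrid β (Set.Ioc_subset_Icc_self hβ) (RSD S) (PS S)) (RSD S))) ∧
      (∀ r ∈ Set.Ico (0 : ℝ) 1, ∃ (β : ℝ) (hβ : β ∈ Set.Ioo (0 : ℝ) 1),
        Mechanism.PartiallyStrategyproof r
          (hybrid β (Set.Ioo_subset_Icc_self hβ) (RSD S) (PS S)) ∧
        ImperfectOrdDominates (hybrid β (Set.Ioo_subset_Icc_self hβ) (RSD S) (PS S)) (RSD S))) ∧
    (∃ (n m : ℕ) (S : Setting (Fin n) (Fin m)),
      StrictImperfectOrdDominates (PS S) (RSD S) ∧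
      ∀ r ∈ Set.Ico (0 : ℝ) 1, ∃ (β : ℝ) (hβ : β ∈ Set.Ioo (0 : ℝ) 1),
        Mechanism.PartiallyStrategyproof r
          (hybrid β (Set.Ioo_subset_Icc_self hβ) (RSD S) (PS S)) ∧
        StrictImperfectOrdDominates
          (hybrid β (Set.Ioo_subset_Icc_self hβ) (RSD S) (PS S)) (RSD S)) := by
  refine ⟨fun S => ⟨RSD_PS_hybridAdmissible S, fun β hβ => ?_, fun r hr => ?_⟩,
    4, 3, fourAgentSetting, ?_, fun r hr => ?_⟩
  · have h := hybrid_imperfectOrdDominates S (Set.Ioc_subset_Icc_self hβ) hβ.1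
    exact ⟨h, fun ⟨t, ht⟩ => ⟨h, t, hybrid_strictOrdDominates S _ hβ.1 ht⟩⟩
  · obtain ⟨β, hβ, h⟩ := exists_hybrid_partiallyStrategyproof S hr
    exact ⟨β, hβ, h, hybrid_imperfectOrdDominates S _ hβ.1⟩
  · exact ⟨PS_imperfectOrdDominates _, fourAgentProfile, fourAgentProfile_strictOrdDominates⟩
  · obtain ⟨β, hβ, h⟩ := exists_hybrid_partiallyStrategyproof fourAgentSetting hr
    exact ⟨β, hβ, h, hybrid_imperfectOrdDominates _ _ hβ.1, fourAgentProfile,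
      hybrid_strictOrdDominates _ _ hβ.1 fourAgentProfile_strictOrdDominates⟩
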